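/- Let $m\ge 1$ be an integer. Let $H$ be the Heisenberg Lie algebra with basis $h_i$ ($i\in\mathbb Z$) and central element acting as $1$, $[h_i,h_j]=i\,\delta_{i+j,0}$. For $\lambda\in\mathbb C$ let $H_\lambda=\mathbb C[h_{-1},h_{-2},\dots]\cdot|\lambda\rangle$ be its Fock module, with $h_i|\lambda\rangle=0$ for $i>0$ and $h_0=\lambda$ on $H_\lambda$. On $\bigoplus_{c\in\mathbb Z}H_{c/\sqrt{2m}}$, the sum of the irreducible modules of the vertex algebra of the lattice $\mathbb Z l$ with $\langle l,l\rangle=2m$, consider the bosonic vertex operator $$\phi_{\sqrt{2m}}(z)=\exp\Big(\sqrt{2m}\sum_{n>0}\frac{h_{-n}}{n}z^{n}\Big)\exp\Big(-\sqrt{2m}\sum_{n>0}\frac{h_{n}}{n}z^{-n}\Big)\,e^{l}\,z^{\sqrt{2m}\,h_0}=\sum_{n\in\mathbb Z}a_nz^{-n-1},$$ where $e^{l}:H_\lambda\to H_{\lambda+\sqrt{2m}}$ commutes with all $h_i$, $i\neq0$, and sends $|\lambda\rangle$ to $|\lambda+\sqrt{2m}\rangle$. For $p\in\mathbb Z$ put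 $v_p=|{-p}/\sqrt{2m}\rangle$, and let the principal subspace $V_{(m),p}=\mathbb C[a_{p-1},a_{p-2},\dots]\cdot v_p$ be the image of $v_p$ under the algebra of operators generated by the $a_i$, $i\le p-1$. Put $V_{(m)}=V_{(m),1-m}=\mathbb C[a_{-m},a_{-m-1},\dots]\cdot v_{1-m}$. **Lemma.** Let $\xi(z)=\sum_{j\ge0}\xi_jz^j$, and let $I_{(m)}\subset\mathbb C[\xi_0,\xi_1,\dots]$ be the ideal generated by all coefficients of the series $(\xi(z)^{(i)})^2$, $0\le i\le m-1$, where $\xi(z)^{(i)}$ is the $i$-th derivative. Then: 1. $I_{(m)}$ is generated by the elements $$\sum_{\substack{\alpha_1+\alpha_2=s\\ \alpha_1,\alpha_2\ge0}}\alpha_1(\alpha_1-1)\cdots(\alpha_1-i+1)\,\alpha_2(\alpha_2-1)\cdots(\alpha_2-i+1)\,\xi_{\alpha_1}\xi_{\alpha_2},\qquad s\ge0,\ 0\le i\le m-1.$$ 2. For every $p\in\mathbb Z$ there is a linear isomorphism $\mathbb C[\xi_0,\xi_1,\dots]/I_{(m)}\to V_{(m),p}$ that sends the class of $1$ to $v_p$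 and turns multiplication by $\xi_j$ into the action of $a_{p-1-j}$ for all $j\ge0$; so it sends the class of $\xi_{j_1}\cdots\xi_{j_k}$ to $a_{p-1-j_1}\cdots a_{p-1-j_k}v_p$. In particular ($p=1-m$, $\xi_j\leftrightarrow a_{-m-j}$), $V_{(m)}$ is isomorphic to $\mathbb C[a_{-m},a_{-m-1},\dots]$ modulo the ideal generated by the coefficients of $(\phi^+(z)^{(i)})^2$, $0\le i\le m-1$, where $\phi^+(z)=a_{-m}+za_{-m-1}+z^2a_{-m-2}+\cdots$. -/

import Mathlib

noncomputable section

namespace LatticeVertex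

open MvPolynomial

/-- The underlying space `ℂ[h₋₁, h₋₂, …]` of each Fock module `H_λ` of the Heisenberg algebra
`[h_i, h_j] = i δ_{i+j,0}`. The variable `X n` is `h₋ₙ`, and `1` is the highest weight vector. -/
abbrev Fock : Type := MvPolynomial ℕ+ ℂ

/-- The creation operator `h₋ₙ`, `n > 0`: multiplication by the variable `X n`. -/
def creation (n : ℕ+) : Module.End ℂ Fock := LinearMap.mulLeft ℂ (X n)

/-- The annihilation operator `hₙ`, `n > 0`: the operator `n ∂/∂h₋ₙ`. -/
def annihilation (n : ℕ+) : Module.End ℂ Fock := ((n : ℕ) : ℂ) • (pderiv n).toLinearMap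

/-- The exponential `∑ⱼ Fʲ / j!` of a formal power series `F` without constant term over a (not
necessarily commutative) algebra. As `Fʲ` has order at least `j`, only the terms with `j ≤ n`
contribute to the coefficient of index `n`. -/
def formalExp {A : Type*} [Ring A] [Algebra ℂ A] (F : PowerSeries A) : PowerSeries A :=
  PowerSeries.mk fun n =>
    ∑ j ∈ Finset.range (n + 1), ((j.factorial : ℂ)⁻¹) • PowerSeries.coeff n (F ^ j)

/-- The series `√(2m) ∑_{n>0} h₋ₙ zⁿ / n` in the variable `z`. -/
def creationSeries (m : ℕ) : PowerSeries (Module.End ℂ Fock) :=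
  PowerSeries.mk fun
    | 0 => 0
    | n + 1 => ((Real.sqrt (2 * m) : ℂ) / ((n + 1 : ℕ) : ℂ)) • creation n.succPNat

/-- The series `-√(2m) ∑_{n>0} hₙ wⁿ / n` in the variable `w = z⁻¹`. -/
def annihilationSeries (m : ℕ) : PowerSeries (Module.End ℂ Fock) :=
  PowerSeries.mk fun
    | 0 => 0
    | n + 1 => (-((Real.sqrt (2 * m) : ℂ) / ((n + 1 : ℕ) : ℂ))) • annihilation n.succPNat

/-- The coefficient of `zⁱ` in `exp (√(2m) ∑_{n>0} h₋ₙ zⁿ / n)`. -/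
def expCreation (m i : ℕ) : Module.End ℂ Fock :=
  PowerSeries.coeff i (formalExp (creationSeries m))

/-- The coefficient of `z⁻ʲ` in `exp (-√(2m) ∑_{n>0} hₙ z⁻ⁿ / n)`. -/
def expAnnihilation (m j : ℕ) : Module.End ℂ Fock :=
  PowerSeries.coeff j (formalExp (annihilationSeries m))

/-- The function `f ↦ f(h₋₁ - √(2m) w, h₋₂ - √(2m) w², …)`. It serves only to show that the sums
below are finite. -/
def translation (m : ℕ) : Fock →ₐ[ℂ] Polynomial Fock :=
  aeval fun n : ℕ+ => Polynomial.C (X n)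
    - Polynomial.C (C (Real.sqrt (2 * m) : ℂ)) * Polynomial.X ^ (n : ℕ)

lemma coeff_pow_eq_zero {A : Type*} [Ring A] {F : PowerSeries A}
    (hF : PowerSeries.coeff 0 F = 0) {n j : ℕ} (h : n < j) :
    PowerSeries.coeff n (F ^ j) = 0 := by
  induction j generalizing n with
  | zero => omega
  | succ j ih =>
    rw [pow_succ, PowerSeries.coeff_mul]
    refine Finset.sum_eq_zero fun x hx => ?_
    rw [Finset.HasAntidiagonal.mem_antidiagonal] at hx
    rcases Nat.eq_zero_or_pos x.2 with h2 | h2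
    · rw [h2, hF, mul_zero]
    · rw [ih (by omega), zero_mul]

lemma coeff_formalExp {A : Type*} [Ring A] [Algebra ℂ A] {F : PowerSeries A}
    (hF : PowerSeries.coeff 0 F = 0) {n N : ℕ} (h : n < N) :
    PowerSeries.coeff n (formalExp F) =
      ∑ j ∈ Finset.range N, ((j.factorial : ℂ)⁻¹) • PowerSeries.coeff n (F ^ j) := by
  rw [formalExp, PowerSeries.coeff_mk]
  refine Finset.sum_subset (fun x hx => ?_) fun x _ hx => ?_
  · simp only [Finset.mem_range] at *
    omega
  · simp only [Finset.mem_range] at *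
    rw [coeff_pow_eq_zero hF (by omega), smul_zero]

/-- Commuting a formal exponential past `x`, when `F x - x F = Z` commutes with `F`. -/
lemma formalExp_mul_of_commutator {A : Type*} [Ring A] [Algebra ℂ A] {F Z : PowerSeries A}
    (hF : PowerSeries.coeff 0 F = 0) (x : A)
    (hZ : F * PowerSeries.C x = PowerSeries.C x * F + Z) (hc : Commute F Z) :
    formalExp F * PowerSeries.C x = PowerSeries.C x * formalExp F + Z * formalExp F := by
  have key : ∀ j : ℕ, F ^ (j + 1) * PowerSeries.C x
      = PowerSeries.C x * F ^ (j + 1) + ((j + 1 : ℕ) : PowerSeries A) * (Z * F ^ j) := by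
    intro j
    induction j with
    | zero => simpa using hZ
    | succ j ih =>
      have h1 : F * (Z * F ^ j) = Z * F ^ (j + 1) := by
        rw [← mul_assoc, hc.eq, mul_assoc, ← pow_succ']
      calc F ^ (j + 1 + 1) * PowerSeries.C x = F * (F ^ (j + 1) * PowerSeries.C x) := by
            rw [pow_succ' F (j + 1), mul_assoc]
        _ = (F * PowerSeries.C x) * F ^ (j + 1)
            + ((j + 1 : ℕ) : PowerSeries A) * (F * (Z * F ^ j)) := by
            rw [ih, mul_add, ← mul_assoc, ← mul_assoc F, ← (Nat.cast_commute (j + 1) F).eq,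
              mul_assoc _ F]
        _ = _ := by
            rw [hZ, h1, add_mul, mul_assoc, ← pow_succ']
            push_cast
            noncomm_ring
  ext n
  have hN : n < n + 2 := by omega
  rw [map_add, PowerSeries.coeff_mul_C, PowerSeries.coeff_C_mul, coeff_formalExp hF hN,
    Finset.sum_mul, Finset.mul_sum]
  have hZE : PowerSeries.coeff n (Z * formalExp F)
      = ∑ j ∈ Finset.range (n + 1),
        ((j.factorial : ℂ)⁻¹) • PowerSeries.coeff n (Z * F ^ j) := by
    rw [PowerSeries.coeff_mul]
    simp_rw [PowerSeries.coeff_mul, Finset.smul_sum]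
    rw [Finset.sum_comm]
    refine Finset.sum_congr rfl fun y hy => ?_
    rw [Finset.HasAntidiagonal.mem_antidiagonal] at hy
    rw [coeff_formalExp hF (show y.2 < n + 1 by omega), Finset.mul_sum]
    exact Finset.sum_congr rfl fun j _ => mul_smul_comm _ _ _
  rw [hZE, Finset.sum_range_succ' _ (n + 1), Finset.sum_range_succ' _ (n + 1)]
  have h0 : ∀ j : ℕ, (((j + 1).factorial : ℂ)⁻¹ • PowerSeries.coeff n (F ^ (j + 1))) * x
      = x * ((((j + 1).factorial : ℂ)⁻¹) • PowerSeries.coeff n (F ^ (j + 1)))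
        + ((j.factorial : ℂ)⁻¹) • PowerSeries.coeff n (Z * F ^ j) := by
    intro j
    have hk := congrArg (PowerSeries.coeff n) (key j)
    rw [PowerSeries.coeff_mul_C, map_add, PowerSeries.coeff_C_mul, ← nsmul_eq_mul, map_nsmul]
      at hk
    rw [smul_mul_assoc, hk, smul_add, mul_smul_comm, ← Nat.cast_smul_eq_nsmul ℂ, smul_smul]
    congr 2
    have : (j.factorial : ℂ) ≠ 0 := by exact_mod_cast j.factorial_ne_zero
    have : ((j : ℂ) + 1) ≠ 0 := by exact_mod_cast j.succ_ne_zero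
    rw [Nat.factorial_succ]
    push_cast
    field_simp
  rw [Finset.sum_congr rfl fun j _ => h0 j, Finset.sum_add_distrib]
  have h1 : (((Nat.factorial 0 : ℕ) : ℂ)⁻¹ • PowerSeries.coeff n (F ^ 0)) * x
      = x * (((Nat.factorial 0 : ℕ) : ℂ)⁻¹ • PowerSeries.coeff n (F ^ 0)) := by
    rcases n with _ | n <;> simp [PowerSeries.coeff_one]
  rw [h1]
  abel

/-- The commutator of the annihilation series with a creation operator. -/
lemma annihilationSeries_mul_creation (m : ℕ) (k : ℕ+) :
    annihilationSeries m * PowerSeries.C (creation k)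
      = PowerSeries.C (creation k) * annihilationSeries m
        + PowerSeries.monomial (k : ℕ) ((-(Real.sqrt (2 * m) : ℂ)) • 1) := by
  ext1 n
  refine LinearMap.ext fun f => ?_
  rw [PowerSeries.coeff_mul_C, map_add, PowerSeries.coeff_C_mul, PowerSeries.coeff_monomial]
  simp only [annihilationSeries, PowerSeries.coeff_mk]
  rcases n with _ | n
  · simp [show (0 : ℕ) ≠ (k : ℕ) from k.pos.ne]
  · have hn0 : ((n + 1 : ℕ) : ℂ) ≠ 0 := by exact_mod_cast n.succ_ne_zero
    have hX : pderiv n.succPNat (X k : Fock) = if n + 1 = (k : ℕ) then 1 else 0 := by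
      split_ifs with h
      · rw [show n.succPNat = k from PNat.eq h, pderiv_X_self]
      · exact pderiv_X_of_ne fun h' => h (by rw [h']; rfl)
    simp only [LinearMap.add_apply, Module.End.mul_apply, LinearMap.smul_apply,
      annihilation, creation, LinearMap.mulLeft_apply, Derivation.coeFn_coe, Derivation.leibniz,
      Nat.succPNat_coe, Nat.succ_eq_add_one, hX, smul_eq_mul, mul_smul_comm, smul_smul, neg_mul,
      smul_add, div_mul_cancel₀ _ hn0]
    split_ifs <;> simp

/-- The Taylor formula: `exp (-√(2m) ∑ hₙ wⁿ / n)` acts as the translation of the variables. -/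
lemma expAnnihilation_eq (m : ℕ) (f : Fock) (j : ℕ) :
    expAnnihilation m j f = (translation m f).coeff j := by
  have hF : PowerSeries.coeff 0 (annihilationSeries m) = 0 := by simp [annihilationSeries]
  induction f using MvPolynomial.induction_on generalizing j with
  | C a =>
    have hD : ∀ (i n : ℕ), 0 < i →
        PowerSeries.coeff n (annihilationSeries m ^ i) (C a : Fock) = 0 := by
      intro i n hi
      obtain ⟨i, rfl⟩ := Nat.exists_eq_add_of_lt hi
      rw [zero_add, pow_succ, PowerSeries.coeff_mul, LinearMap.sum_apply]
      refine Finset.sum_eq_zero fun y _ => ?_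
      rw [Module.End.mul_apply]
      have h0 : PowerSeries.coeff y.2 (annihilationSeries m) (C a : Fock) = 0 := by
        simp only [annihilationSeries, PowerSeries.coeff_mk]
        split <;> simp [annihilation]
      rw [h0, map_zero]
    rw [expAnnihilation, formalExp, PowerSeries.coeff_mk, LinearMap.sum_apply,
      Finset.sum_eq_single 0]
    · have : translation m (C a) = Polynomial.C (C a) := by
        rw [translation, aeval_C, IsScalarTower.algebraMap_apply ℂ Fock (Polynomial Fock)]
        rfl
      rw [this, Polynomial.coeff_C]
      rcases j with _ | j <;> simp [PowerSeries.coeff_one]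
    · intro i _ hi
      rw [LinearMap.smul_apply, hD i j (Nat.pos_of_ne_zero hi), smul_zero]
    · simp
  | add p q hp hq => rw [map_add, map_add, Polynomial.coeff_add, hp, hq]
  | mul_X p k hp =>
    have hc : Commute (annihilationSeries m)
        (PowerSeries.monomial (k : ℕ) ((-(Real.sqrt (2 * m) : ℂ)) • (1 : Module.End ℂ Fock))) := by
      have : PowerSeries.monomial (k : ℕ) ((-(Real.sqrt (2 * m) : ℂ)) • (1 : Module.End ℂ Fock))
          = PowerSeries.C ((-(Real.sqrt (2 * m) : ℂ)) • (1 : Module.End ℂ Fock))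
            * PowerSeries.X ^ (k : ℕ) := by
        ext1 n
        rw [PowerSeries.coeff_monomial, PowerSeries.coeff_C_mul_X_pow]
      rw [this]
      refine Commute.mul_right ?_ ((PowerSeries.commute_X_pow _ _))
      ext1 n
      rw [PowerSeries.coeff_C_mul, PowerSeries.coeff_mul_C, smul_mul_assoc, mul_smul_comm,
        one_mul, mul_one]
    have h := congrArg (fun G : PowerSeries (Module.End ℂ Fock) => (PowerSeries.coeff j G : Module.End ℂ Fock) p)
      (formalExp_mul_of_commutator hF _ (annihilationSeries_mul_creation m k) hc)
    simp only [PowerSeries.coeff_mul_C, map_add, PowerSeries.coeff_C_mul, LinearMap.add_apply,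
      Module.End.mul_apply] at h
    have hX : p * X k = creation k p := by simp [creation, mul_comm]
    rw [hX]
    change PowerSeries.coeff j (formalExp (annihilationSeries m)) (creation k p) = _
    rw [h, ← hX]
    have hT : translation m (X k) = Polynomial.C (X k)
        - Polynomial.C (C (Real.sqrt (2 * m) : ℂ)) * Polynomial.X ^ (k : ℕ) := by
      simp [translation]
    rw [map_mul (translation m), hT, mul_sub, Polynomial.coeff_sub, Polynomial.coeff_mul_C, ← hp, ← mul_assoc,
      Polynomial.coeff_mul_X_pow', sub_eq_add_neg]
    congr 1
    · simp [creation, expAnnihilation, mul_comm]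
    · rw [PowerSeries.coeff_mul]
      split_ifs with hkj
      · rw [Polynomial.coeff_mul_C, ← hp, LinearMap.sum_apply,
          Finset.sum_eq_single ((k : ℕ), j - k)]
        · rw [PowerSeries.coeff_monomial_same]
          simp only [Module.End.mul_apply, LinearMap.smul_apply, Module.End.one_apply,
            expAnnihilation, neg_smul]
          rw [MvPolynomial.smul_eq_C_mul, mul_comm]
        · intro y hy hne
          rw [Finset.HasAntidiagonal.mem_antidiagonal] at hy
          rw [PowerSeries.coeff_monomial, if_neg, zero_mul, LinearMap.zero_apply]
          intro h'
          exact hne (Prod.ext h' (by simp only; omega))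
        · intro h'
          exact absurd (Finset.HasAntidiagonal.mem_antidiagonal.2 (by simp only; omega)) h'
      · rw [LinearMap.sum_apply, neg_zero]
        refine Finset.sum_eq_zero fun y hy => ?_
        rw [Finset.HasAntidiagonal.mem_antidiagonal] at hy
        rw [PowerSeries.coeff_monomial, if_neg (by omega), zero_mul, LinearMap.zero_apply]

/-- The exponential of the annihilation operators is locally finite. -/
lemma finite_expAnnihilation (m : ℕ) (g : ℕ → Module.End ℂ Fock) (f : Fock) :
    (Function.support fun j : ℕ => g j (expAnnihilation m j f)).Finite := by
  refine (Set.finite_Iic (translation m f).natDegree).subset fun j hj => ?_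
  by_contra h
  refine hj ?_
  simp only [Set.mem_Iic, not_le] at h
  simp only [expAnnihilation_eq, Polynomial.coeff_eq_zero_of_natDegree_lt h, map_zero]

/-- The coefficient of `zᵏ` in the normally ordered exponential
`exp (√(2m) ∑_{n>0} h₋ₙ zⁿ / n) exp (-√(2m) ∑_{n>0} hₙ z⁻ⁿ / n)`. Applied to any vector the sum
has finitely many nonzero terms. -/
def normalOrderedCoeff (m : ℕ) (k : ℤ) : Module.End ℂ Fock where
  toFun f := ∑ᶠ j : ℕ,
    (if 0 ≤ k + j then expCreation m (k + j).toNat else 0) (expAnnihilation m j f)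
  map_add' f g := by
    simp only [map_add]
    exact finsum_add_distrib (finite_expAnnihilation m _ f) (finite_expAnnihilation m _ g)
  map_smul' r f := by
    simp only [map_smul, RingHom.id_apply]
    exact (smul_finsum r _).symm

/-- The sum `⨁ H_{c/√(2m)}` over `c ∈ ℤ` of Fock modules, that is, the direct sum of all
irreducible modules of the vertex algebra of the lattice `ℤ l` with `⟨l, l⟩ = 2m`. The summand of
index `c` is `H_{c/√(2m)}`: on it `h₀` acts as the scalar `c/√(2m)`. -/
abbrev FockSum : Type := ℤ →₀ Fock

/-- The mode `aₙ`, the coefficient of `z⁻ⁿ⁻¹` in the bosonic vertex operator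
`exp (√(2m) ∑_{n>0} h₋ₙ zⁿ / n) exp (-√(2m) ∑_{n>0} hₙ z⁻ⁿ / n) e^l z^{√(2m) h₀}`, where `e^l` maps
`H_λ` to `H_{λ+√(2m)}` identically, so the index `c` goes to `c + 2m`. On the summand of index `c`,
`z^{√(2m) h₀}` is `z^c`. -/
def mode (m : ℕ) (n : ℤ) : Module.End ℂ FockSum :=
  Finsupp.lsum ℂ fun c : ℤ =>
    (Finsupp.lsingle (c + 2 * m) : Fock →ₗ[ℂ] FockSum) ∘ₗ normalOrderedCoeff m (-n - 1 - c)

/-- The extremal vector `v_p`, the highest weight vector of `H_{-p/√(2m)}`. -/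
def extremalVector (p : ℤ) : FockSum := Finsupp.single (-p) 1

/-- The principal subspace `V_{(m),p} = ℂ[a_{p-1}, a_{p-2}, …] · v_p`: the vectors `T v_p`, where
`T` runs over the algebra of operators generated by the modes `a_i`, `i ≤ p - 1`. -/
def principalSubspace (m : ℕ) (p : ℤ) : Submodule ℂ FockSum :=
  (Subalgebra.toSubmodule (Algebra.adjoin ℂ (mode m '' Set.Iic (p - 1)))).map
    (LinearMap.applyₗ (extremalVector p))

/-- The generating series `ξ₀ + ξ₁ z + ξ₂ z² + ⋯` of the variables of `ℂ[ξ₀, ξ₁, …]`. -/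
def genSeries : PowerSeries (MvPolynomial ℕ ℂ) := PowerSeries.mk fun j => X j

/-- The ideal generated by all coefficients of the squares of the derivatives of order
`0, …, m - 1` of the generating series. -/
def relationIdeal (m : ℕ) : Ideal (MvPolynomial ℕ ℂ) :=
  Ideal.span {r | ∃ i < m, ∃ s : ℕ, r = PowerSeries.coeff s
    (((PowerSeries.derivative (MvPolynomial ℕ ℂ))^[i] genSeries) ^ 2)}

end LatticeVertex

end

noncomputable section

namespace LatticeVertex

open MvPolynomial

/-! Write Qₙ for the coefficient of zⁿ in exp(√(2m) ∑ h₋ₙ zⁿ/n)·1 and N_k for the zᵏ-coefficient of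
the normally ordered exponential. The annihilation half translates the variables, and translation by
w multiplies the series of the Qₙ by (1 - wz)^{2m} (`map_translation_formalExp`). Hence N_k(Qₙ g) =
∑ₗ (-1)ˡ C(2m,l) Q_{n-l} N_{k+l} g, from which the rest follows.

Relations hold: since 2m is even, expanding a product of two operators gives a symmetric expression,
so the modes commute (`mode_comm`). Thus ℂ[ξ₀, ξ₁, …] acts, and `orbitMap` maps it onto the
principal subspace. On v_p a quadratic relation turns into 2m-th finite differences of a polynomial
of degree 2i < 2m, which vanish.

No further relations: call a monomial separated if its indices, in decreasing order, have gaps at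
least 2m. Separated monomials span modulo the ideal (`prod_X_mem`): for fixed α₁ + α₂ the weights
(α₁)ᵢ(α₂)ᵢ are monic of degree i in α₁α₂, so all weights of degree < m are available, and
interpolation trades any of the at most m close pairs for distant ones. Their images are independent
(`eq_zero_of_orbitMap_eq_zero`): written in Q₁, Q₂, … they are triangular for the lexicographic
order. So the kernel is exactly the ideal (`ker_orbitMap`). -/

/-! ### Formal exponentials and linear differential equations -/

lemma map_formalExp {A B : Type*} [Ring A] [Ring B] [Algebra ℂ A] [Algebra ℂ B] (φ : A →ₐ[ℂ] B)
    (F : PowerSeries A) :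
    formalExp (PowerSeries.map (φ : A →+* B) F) = PowerSeries.map (φ : A →+* B) (formalExp F) := by
  ext n
  simp only [formalExp, PowerSeries.coeff_mk, PowerSeries.coeff_map, ← map_pow]
  simp

lemma constantCoeff_formalExp {A : Type*} [Ring A] [Algebra ℂ A] (F : PowerSeries A) :
    PowerSeries.coeff 0 (formalExp F) = 1 := by
  simp [formalExp]

/-- The formal exponential solves the differential equation `E' = F' E`. -/
lemma derivative_formalExp {A : Type*} [CommRing A] [Algebra ℂ A] {F : PowerSeries A}
    (hF : PowerSeries.coeff 0 F = 0) :
    PowerSeries.derivative A (formalExp F) = PowerSeries.derivative A F * formalExp F := by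
  ext n
  have hR : PowerSeries.coeff n (PowerSeries.derivative A F * formalExp F)
      = ∑ j ∈ Finset.range (n + 1),
        ((j.factorial : ℂ)⁻¹) • PowerSeries.coeff n (PowerSeries.derivative A F * F ^ j) := by
    rw [PowerSeries.coeff_mul]
    simp_rw [PowerSeries.coeff_mul, Finset.smul_sum]
    rw [Finset.sum_comm]
    refine Finset.sum_congr rfl fun y hy => ?_
    rw [Finset.HasAntidiagonal.mem_antidiagonal] at hy
    rw [coeff_formalExp hF (show y.2 < n + 1 by omega), Finset.mul_sum]
    exact Finset.sum_congr rfl fun j _ => mul_smul_comm _ _ _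
  rw [hR, PowerSeries.coeff_derivative, coeff_formalExp hF (show n + 1 < n + 2 by omega),
    Finset.sum_range_succ', add_mul]
  have h0 : (((Nat.factorial 0 : ℕ) : ℂ)⁻¹ • PowerSeries.coeff (n + 1) (F ^ 0)) * ((n : A) + 1)
      = 0 := by
    simp [PowerSeries.coeff_one]
  rw [Finset.sum_mul, h0, add_zero]
  refine Finset.sum_congr rfl fun j _ => ?_
  have hd := congrArg (PowerSeries.coeff n)
    (Derivation.leibniz_pow (PowerSeries.derivative A) F (j + 1))
  rw [PowerSeries.coeff_derivative, Nat.add_sub_cancel, map_nsmul, smul_eq_mul,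
    mul_comm (F ^ j)] at hd
  rw [smul_mul_assoc, hd, ← Nat.cast_smul_eq_nsmul ℂ, smul_smul]
  congr 1
  have : (j.factorial : ℂ) ≠ 0 := by exact_mod_cast j.factorial_ne_zero
  have : ((j : ℂ) + 1) ≠ 0 := by exact_mod_cast j.succ_ne_zero
  rw [Nat.factorial_succ]
  push_cast
  field_simp

/-- Solutions of a linear differential equation of first order are determined by their constant
coefficient. -/
lemma eq_of_derivative_eq {A : Type*} [CommRing A] [IsDomain A] [CharZero A]
    {F G H : PowerSeries A} (hF : PowerSeries.derivative A F = H * F)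
    (hG : PowerSeries.derivative A G = H * G)
    (h0 : PowerSeries.coeff 0 F = PowerSeries.coeff 0 G) : F = G := by
  ext n
  induction n using Nat.strong_induction_on with
  | _ n ih =>
    rcases n with _ | n
    · exact h0
    · have h1 := congrArg (PowerSeries.coeff n) hF
      have h2 := congrArg (PowerSeries.coeff n) hG
      rw [PowerSeries.coeff_derivative, PowerSeries.coeff_mul] at h1 h2
      have hne : ((n : A) + 1) ≠ 0 := Nat.cast_add_one_ne_zero n
      refine mul_right_cancel₀ hne ?_
      rw [h1, h2]
      refine Finset.sum_congr rfl fun y hy => ?_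
      rw [Finset.HasAntidiagonal.mem_antidiagonal] at hy
      rw [ih y.2 (by omega)]

/-! ### The vectors Qₙ and their translation -/

/-- The series `√(2m) ∑_{n>0} h₋ₙ zⁿ / n` with coefficients in the Fock space. -/
def fockSeries (m : ℕ) : PowerSeries Fock :=
  PowerSeries.mk fun
    | 0 => 0
    | n + 1 => ((Real.sqrt (2 * m) : ℂ) / ((n + 1 : ℕ) : ℂ)) • X n.succPNat

lemma coeff_zero_fockSeries (m : ℕ) : PowerSeries.coeff 0 (fockSeries m) = 0 := by
  simp [fockSeries]

/-- The vector `Qₙ`, the coefficient of `zⁿ` in `exp (√(2m) ∑_{n>0} h₋ₙ zⁿ / n) · 1`. -/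
def schur (m n : ℕ) : Fock := PowerSeries.coeff n (formalExp (fockSeries m))

lemma schur_zero (m : ℕ) : schur m 0 = 1 := constantCoeff_formalExp _

/-- Creation operators are multiplications, so their exponential can be computed in the commutative
ring `Fock` and becomes multiplication by Qₙ. -/
lemma creationSeries_eq_map (m : ℕ) :
    creationSeries m = PowerSeries.map ((Algebra.lmul ℂ Fock : Fock →ₐ[ℂ] Module.End ℂ Fock) :
      Fock →+* Module.End ℂ Fock) (fockSeries m) := by
  ext1 n
  rw [PowerSeries.coeff_map]
  rcases n with _ | n
  · simp [creationSeries, fockSeries]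
  · simp only [creationSeries, fockSeries, PowerSeries.coeff_mk, RingHom.coe_coe, map_smul]
    rfl

lemma expCreation_apply (m n : ℕ) (f : Fock) : expCreation m n f = schur m n * f := by
  rw [expCreation, creationSeries_eq_map, map_formalExp, PowerSeries.coeff_map]
  rfl

lemma coeff_derivative_fockSeries (m n : ℕ) :
    PowerSeries.coeff n (PowerSeries.derivative Fock (fockSeries m))
      = (Real.sqrt (2 * m) : ℂ) • X n.succPNat := by
  rw [PowerSeries.coeff_derivative, fockSeries, PowerSeries.coeff_mk]
  have : ((n : Fock) + 1) = C ((n + 1 : ℕ) : ℂ) := by simp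
  rw [this, mul_comm, ← MvPolynomial.smul_eq_C_mul, smul_smul, mul_div_cancel₀]
  exact_mod_cast n.succ_ne_zero

/-- Newton's recursion `n Qₙ = √(2m) ∑ h₋ᵢ Qₙ₋ᵢ`. -/
lemma schur_succ (m n : ℕ) :
    schur m (n + 1) * ((n : Fock) + 1) = ∑ y ∈ Finset.HasAntidiagonal.antidiagonal n,
      (Real.sqrt (2 * m) : ℂ) • (X y.1.succPNat * schur m y.2) := by
  have h := congrArg (PowerSeries.coeff n) (derivative_formalExp (coeff_zero_fockSeries m))
  rw [PowerSeries.coeff_derivative, PowerSeries.coeff_mul] at h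
  simp only [coeff_derivative_fockSeries, smul_mul_assoc] at h
  exact h

lemma translation_X (m : ℕ) (k : ℕ+) : translation m (X k) = Polynomial.C (X k)
    - Polynomial.C (C (Real.sqrt (2 * m) : ℂ)) * Polynomial.X ^ (k : ℕ) := by
  simp [translation]

/-- The vector `Qₙ` for an integer `n`; it vanishes for `n < 0`. -/
def schurInt (m : ℕ) (n : ℤ) : Fock := if 0 ≤ n then schur m n.toNat else 0

lemma schurInt_natCast (m n : ℕ) : schurInt m n = schur m n := by simp [schurInt]

lemma schurInt_of_neg (m : ℕ) {n : ℤ} (h : n < 0) : schurInt m n = 0 := if_neg h.not_ge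

lemma derivative_one_sub_pow_mul {A : Type*} [CommRing A] (x : A) (k : ℕ) (F : PowerSeries A) :
    PowerSeries.derivative A ((1 - PowerSeries.C x * PowerSeries.X) ^ (k + 1) * F)
      = (1 - PowerSeries.C x * PowerSeries.X) ^ (k + 1) * PowerSeries.derivative A F
        - ((k + 1 : ℕ) : PowerSeries A) * PowerSeries.C x
          * (1 - PowerSeries.C x * PowerSeries.X) ^ k * F := by
  have h : PowerSeries.derivative A (1 - PowerSeries.C x * PowerSeries.X) = -PowerSeries.C x := by
    ext1 n
    rw [PowerSeries.coeff_derivative, map_sub, PowerSeries.coeff_C_mul, PowerSeries.coeff_X,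
      PowerSeries.coeff_one, map_neg, PowerSeries.coeff_C]
    rcases n with _ | n <;> simp
  rw [Derivation.leibniz, Derivation.leibniz_pow, h]
  simp only [smul_eq_mul, nsmul_eq_mul, Nat.add_sub_cancel]
  ring

/-- `exp (√(2m) ∑ h₋ₙ zⁿ / n)` is multiplied by `(1 - w z)^{2m}` under translation by `w`. -/
lemma map_translation_formalExp (m : ℕ) (hm : 1 ≤ m) :
    PowerSeries.map (translation m).toRingHom
        (formalExp (fockSeries m))
      = (1 - PowerSeries.C Polynomial.X * PowerSeries.X) ^ (2 * m)
        * PowerSeries.map (Polynomial.C : Fock →+* Polynomial Fock) (formalExp (fockSeries m)) := by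
  set D := PowerSeries.derivative (Polynomial Fock)
  set τ : Fock →+* Polynomial Fock := (translation m).toRingHom
  set Q := formalExp (fockSeries m)
  -- This is -2mw/(1 - wz), the logarithmic derivative of (1 - wz)^{2m}. Both sides of the claim
  -- solve E' = (F' + G) E with constant coefficient 1, where F is `fockSeries m`.
  set G : PowerSeries (Polynomial Fock) :=
    PowerSeries.mk fun n => -((2 * m : ℕ) : Polynomial Fock) * Polynomial.X ^ (n + 1) with hG
  have hmap : ∀ (φ : Fock →+* Polynomial Fock) (F : PowerSeries Fock),
      D (PowerSeries.map φ F) = PowerSeries.map φ (PowerSeries.derivative Fock F) := by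
    intro φ F
    ext1 n
    simp [D, PowerSeries.coeff_derivative, PowerSeries.coeff_map]
  have hQ := derivative_formalExp (coeff_zero_fockSeries m)
  have hs : (Real.sqrt (2 * m) : ℂ) * (Real.sqrt (2 * m) : ℂ) = ((2 * m : ℕ) : ℂ) := by
    rw [← Complex.ofReal_mul, Real.mul_self_sqrt (by positivity)]
    push_cast
    rfl
  have hτF : PowerSeries.map τ (PowerSeries.derivative Fock (fockSeries m))
      = PowerSeries.map Polynomial.C (PowerSeries.derivative Fock (fockSeries m)) + G := by
    ext1 n
    rw [map_add, PowerSeries.coeff_map, PowerSeries.coeff_map, coeff_derivative_fockSeries, hG,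
      PowerSeries.coeff_mk]
    simp only [τ, AlgHom.toRingHom_eq_coe, RingHom.coe_coe, map_smul, translation_X]
    rw [MvPolynomial.smul_eq_C_mul, smul_sub, map_mul, Algebra.smul_def, Algebra.smul_def,
      IsScalarTower.algebraMap_apply ℂ Fock (Polynomial Fock), Polynomial.algebraMap_apply,
      Algebra.algebraMap_self_apply, MvPolynomial.algebraMap_eq, ← mul_assoc, ← map_mul, ← map_mul,
      ← map_mul, hs, sub_eq_add_neg, ← neg_mul, map_natCast, map_natCast]
    rfl
  have hG1 : (1 - PowerSeries.C Polynomial.X * PowerSeries.X) * G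
      = -(((2 * m : ℕ) : PowerSeries (Polynomial Fock)) * PowerSeries.C Polynomial.X) := by
    ext1 n
    rw [sub_mul, one_mul, mul_assoc, map_sub, PowerSeries.coeff_C_mul, hG, PowerSeries.coeff_mk,
      map_neg, ← nsmul_eq_mul, map_nsmul, PowerSeries.coeff_C]
    rcases n with _ | n
    · simp
      ring
    · rw [PowerSeries.coeff_succ_X_mul, PowerSeries.coeff_mk]
      simp only [Nat.add_eq_zero_iff, one_ne_zero, and_false, if_false, smul_zero, neg_zero]
      ring
  refine eq_of_derivative_eq
    (H := PowerSeries.map Polynomial.C (PowerSeries.derivative Fock (fockSeries m)) + G) ?_ ?_ ?_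
  · change D _ = _
    rw [hmap, hQ, map_mul, hτF]
  · change D _ = _
    obtain ⟨k, hk⟩ : ∃ k, 2 * m = k + 1 := ⟨2 * m - 1, by omega⟩
    rw [hk, derivative_one_sub_pow_mul, hmap, hQ, map_mul]
    rw [hk] at hG1
    set U : PowerSeries (Polynomial Fock) := 1 - PowerSeries.C Polynomial.X * PowerSeries.X
    set B := PowerSeries.map (Polynomial.C : Fock →+* Polynomial Fock) Q
    linear_combination (-U ^ k * B) * hG1
  · simp only [PowerSeries.coeff_zero_eq_constantCoeff, map_mul, map_pow, map_sub]
    simp only [← PowerSeries.coeff_zero_eq_constantCoeff_apply, PowerSeries.coeff_map, Q,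
      constantCoeff_formalExp]
    simp

lemma coeff_one_sub_pow_mul {A : Type*} [CommRing A] (x : A) (N n : ℕ) (F : PowerSeries A) :
    PowerSeries.coeff n ((1 - PowerSeries.C x * PowerSeries.X) ^ N * F)
      = ∑ l ∈ Finset.range (N + 1), ((-1 : ℤ) ^ l * N.choose l) •
        ((if l ≤ n then PowerSeries.coeff (n - l) F else 0) * x ^ l) := by
  rw [sub_eq_neg_add, add_pow, Finset.sum_mul, map_sum]
  refine Finset.sum_congr rfl fun l _ => ?_
  have : (-(PowerSeries.C x * PowerSeries.X)) ^ l * 1 ^ (N - l) * (N.choose l : PowerSeries A)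
      = ((-1 : ℤ) ^ l * N.choose l) • (PowerSeries.C (x ^ l) * PowerSeries.X ^ l) := by
    rw [neg_pow, mul_pow, zsmul_eq_mul]
    push_cast
    simp only [map_pow]
    ring
  rw [this, smul_mul_assoc, map_zsmul, mul_assoc, PowerSeries.coeff_C_mul,
    PowerSeries.coeff_X_pow_mul', mul_comm (x ^ l)]

lemma translation_schurInt (m : ℕ) (hm : 1 ≤ m) (n : ℤ) :
    translation m (schurInt m n) = ∑ l ∈ Finset.range (2 * m + 1),
      ((-1 : ℤ) ^ l * (2 * m).choose l) •
        (Polynomial.C (schurInt m (n - l)) * Polynomial.X ^ l) := by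
  rcases lt_or_ge n 0 with hn | hn
  · rw [schurInt_of_neg m hn, map_zero]
    refine (Finset.sum_eq_zero fun l _ => ?_).symm
    rw [schurInt_of_neg m (by omega), map_zero, zero_mul, smul_zero]
  · obtain ⟨n, rfl⟩ := Int.eq_ofNat_of_zero_le hn
    have h := congrArg (PowerSeries.coeff n) (map_translation_formalExp m hm)
    rw [PowerSeries.coeff_map] at h
    change translation m (schur m n) = _ at h
    change translation m (schurInt m (n : ℤ)) = _
    rw [schurInt_natCast, h, coeff_one_sub_pow_mul]
    refine Finset.sum_congr rfl fun l _ => ?_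
    congr 2
    split_ifs with hl
    · rw [PowerSeries.coeff_map]
      congr 1
      rw [← Nat.cast_sub hl, schurInt_natCast]
      rfl
    · rw [schurInt_of_neg m (by omega), map_zero]

/-! ### The operators N_k and their product formula -/

/-- The `Fock`-linear map sending `wʲ` to `Q_{k+j}`. -/
def contract (m : ℕ) (k : ℤ) : Polynomial Fock →ₗ[Fock] Fock :=
  Polynomial.lsum fun j => LinearMap.mulLeft Fock (schurInt m (k + j))

lemma contract_eq_sum (m : ℕ) (k : ℤ) (P : Polynomial Fock) {M : ℕ} (hM : P.natDegree < M) :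
    contract m k P = ∑ j ∈ Finset.range M, schurInt m (k + j) * P.coeff j :=
  Polynomial.sum_over_range' P (fun n => by simp) M hM

lemma contract_mul_X_pow (m : ℕ) (k : ℤ) (P : Polynomial Fock) (l : ℕ) :
    contract m k (Polynomial.X ^ l * P) = contract m (k + l) P := by
  induction P using Polynomial.induction_on' with
  | add p q hp hq => rw [mul_add, map_add, map_add, hp, hq]
  | monomial n a =>
    rw [Polynomial.X_pow_mul_monomial]
    rw [contract, contract, Polynomial.lsum_apply, Polynomial.lsum_apply,
      Polynomial.sum_monomial_index _ _ (LinearMap.map_zero _),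
      Polynomial.sum_monomial_index _ _ (LinearMap.map_zero _), Nat.cast_add, add_comm (n : ℤ),
      ← add_assoc]

/-- The annihilation half produces the coefficients of wʲ in the translate of f, and the creation
half multiplies them by Q_{k+j}. In this form the multiplicativity of translation becomes usable. -/
lemma normalOrderedCoeff_eq_contract (m : ℕ) (k : ℤ) (f : Fock) :
    normalOrderedCoeff m k f = contract m k (translation m f) := by
  rw [contract_eq_sum m k _ (Nat.lt_succ_self _)]
  change ∑ᶠ j : ℕ, (if 0 ≤ k + j then expCreation m (k + j).toNat else 0) (expAnnihilation m j f)
    = _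
  have h : ∀ j : ℕ, (if 0 ≤ k + j then expCreation m (k + j).toNat else 0) (expAnnihilation m j f)
      = schurInt m (k + j) * (translation m f).coeff j := by
    intro j
    rw [schurInt, ← expAnnihilation_eq]
    split_ifs
    · rw [expCreation_apply]
    · simp
  simp_rw [h]
  refine finsum_eq_sum_of_support_subset _ fun j hj => ?_
  by_contra hlt
  refine hj ?_
  have : (translation m f).natDegree < j := by simpa using hlt
  simp only [Polynomial.coeff_eq_zero_of_natDegree_lt this, mul_zero]

lemma normalOrderedCoeff_eq_sum (m : ℕ) (k : ℤ) (f : Fock) {M : ℕ}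
    (hM : (translation m f).natDegree < M) :
    normalOrderedCoeff m k f
      = ∑ j ∈ Finset.range M, schurInt m (k + j) * expAnnihilation m j f := by
  rw [normalOrderedCoeff_eq_contract, contract_eq_sum m k _ hM]
  simp only [expAnnihilation_eq]

/-- Translation is multiplicative and known on Qₙ; each factor wˡ shifts the index k by l. -/
lemma normalOrderedCoeff_schurInt_mul (m : ℕ) (hm : 1 ≤ m) (k n : ℤ) (g : Fock) :
    normalOrderedCoeff m k (schurInt m n * g) = ∑ l ∈ Finset.range (2 * m + 1),
      ((-1 : ℤ) ^ l * (2 * m).choose l) •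
        (schurInt m (n - l) * normalOrderedCoeff m (k + l) g) := by
  rw [normalOrderedCoeff_eq_contract, map_mul, translation_schurInt m hm, Finset.sum_mul, map_sum]
  refine Finset.sum_congr rfl fun l _ => ?_
  rw [smul_mul_assoc, map_zsmul, mul_assoc, ← Polynomial.smul_eq_C_mul, map_smul,
    contract_mul_X_pow, smul_eq_mul, normalOrderedCoeff_eq_contract]

lemma normalOrderedCoeff_one (m : ℕ) (k : ℤ) : normalOrderedCoeff m k 1 = schurInt m k := by
  rw [normalOrderedCoeff_eq_contract, map_one, contract_eq_sum m k 1 (M := 1) (by simp)]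
  simp

/-! ### Locality and commutation of the modes -/

lemma commute_coeff_pow {A : Type*} [Ring A] {F : PowerSeries A} {x : A}
    (h : ∀ n, Commute (PowerSeries.coeff n F) x) (j n : ℕ) :
    Commute (PowerSeries.coeff n (F ^ j)) x := by
  induction j generalizing n with
  | zero =>
    rw [pow_zero, PowerSeries.coeff_one]
    split_ifs
    · exact Commute.one_left x
    · exact Commute.zero_left x
  | succ j ih =>
    rw [pow_succ, PowerSeries.coeff_mul]
    exact Commute.sum_left _ _ _ fun y _ => (ih y.1).mul_left (h y.2)

lemma commute_coeff_formalExp {A : Type*} [Ring A] [Algebra ℂ A] {F : PowerSeries A} {x : A}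
    (h : ∀ n, Commute (PowerSeries.coeff n F) x) (n : ℕ) :
    Commute (PowerSeries.coeff n (formalExp F)) x := by
  rw [formalExp, PowerSeries.coeff_mk]
  exact Commute.sum_left _ _ _ fun j _ => (commute_coeff_pow h j n).smul_left _

lemma commute_annihilation (i j : ℕ+) : Commute (annihilation i) (annihilation j) := by
  have h : ⁅(pderiv i : Derivation ℂ Fock Fock), (pderiv j : Derivation ℂ Fock Fock)⁆ = 0 := by
    refine MvPolynomial.derivation_ext fun k => ?_
    classical
    rw [Derivation.commutator_apply, pderiv_X, pderiv_X]
    simp only [Pi.single_apply]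
    split_ifs <;> simp
  have hc : Commute (pderiv i : Derivation ℂ Fock Fock).toLinearMap
      (pderiv j : Derivation ℂ Fock Fock).toLinearMap := by
    refine LinearMap.ext fun f => ?_
    have := DFunLike.congr_fun h f
    rw [Derivation.commutator_apply] at this
    exact sub_eq_zero.mp this
  exact (hc.smul_left _).smul_right _

lemma commute_expAnnihilation (m i j : ℕ) :
    Commute (expAnnihilation m i) (expAnnihilation m j) := by
  have h : ∀ i j, Commute (PowerSeries.coeff i (annihilationSeries m))
      (PowerSeries.coeff j (annihilationSeries m)) := by
    intro i j
    simp only [annihilationSeries, PowerSeries.coeff_mk]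
    rcases i with _ | i
    · exact Commute.zero_left _
    rcases j with _ | j
    · exact Commute.zero_right _
    exact ((commute_annihilation _ _).smul_left _).smul_right _
  exact commute_coeff_formalExp (fun i => (commute_coeff_formalExp (fun j => h j i) j).symm) i

/-- A common bound for both layers of annihilation operators gives the double sums in the locality
proof the same range, so they can be interchanged. -/
lemma exists_natDegree_translation_lt (m : ℕ) (f : Fock) : ∃ M : ℕ,
    (translation m f).natDegree < M ∧
      ∀ j, (translation m (expAnnihilation m j f)).natDegree < M := by
  refine ⟨(translation m f).natDegree + (∑ j ∈ Finset.range ((translation m f).natDegree + 1),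
    (translation m (expAnnihilation m j f)).natDegree) + 1, by omega, fun j => ?_⟩
  rcases Nat.lt_or_ge (translation m f).natDegree j with h | h
  · rw [expAnnihilation_eq, Polynomial.coeff_eq_zero_of_natDegree_lt h]
    simp
  · have := Finset.single_le_sum
      (f := fun j => (translation m (expAnnihilation m j f)).natDegree) (fun _ _ => Nat.zero_le _)
      (Finset.mem_range.2 (Nat.lt_succ_of_le h))
    simp only [Nat.succ_eq_add_one] at this
    omega

lemma normalOrderedCoeff_normalOrderedCoeff (m : ℕ) (hm : 1 ≤ m) (x y : ℤ) (f : Fock) {M : ℕ}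
    (hM : (translation m f).natDegree < M)
    (hM' : ∀ j, (translation m (expAnnihilation m j f)).natDegree < M) :
    normalOrderedCoeff m x (normalOrderedCoeff m y f)
      = ∑ l ∈ Finset.range (2 * m + 1), ((-1 : ℤ) ^ l * (2 * m).choose l) •
        ∑ j ∈ Finset.range M, ∑ i ∈ Finset.range M, schurInt m (y - l + j) *
          (schurInt m (x + l + i) * expAnnihilation m i (expAnnihilation m j f)) := by
  have h : ∀ j : ℕ, normalOrderedCoeff m x (schurInt m (y + j) * expAnnihilation m j f)
      = ∑ l ∈ Finset.range (2 * m + 1), ((-1 : ℤ) ^ l * (2 * m).choose l) •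
        ∑ i ∈ Finset.range M, schurInt m (y - l + j) *
          (schurInt m (x + l + i) * expAnnihilation m i (expAnnihilation m j f)) := by
    intro j
    rw [normalOrderedCoeff_schurInt_mul m hm]
    refine Finset.sum_congr rfl fun l _ => ?_
    rw [normalOrderedCoeff_eq_sum m _ _ (hM' j), Finset.mul_sum, sub_add_eq_add_sub]
  rw [normalOrderedCoeff_eq_sum m y f hM, map_sum, Finset.sum_congr rfl fun j _ => h j,
    Finset.sum_comm]
  exact Finset.sum_congr rfl fun l _ => (Finset.smul_sum).symm

lemma neg_one_pow_two_mul_sub {m l : ℕ} (h : l ≤ 2 * m) : (-1 : ℤ) ^ (2 * m - l) = (-1) ^ l := by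
  have : (-1 : ℤ) ^ (2 * m - l) * (-1) ^ l = 1 := by
    rw [← pow_add, Nat.sub_add_cancel h, pow_mul]
    simp
  rcases neg_one_pow_eq_or ℤ l with h | h <;> rw [h] at this ⊢ <;> linarith

/-- Locality: the operators `N_k` of exponent `2m` commute up to a shift of the indices. -/
lemma normalOrderedCoeff_comm (m : ℕ) (hm : 1 ≤ m) (x y : ℤ) (f : Fock) :
    normalOrderedCoeff m (x - 2 * m) (normalOrderedCoeff m y f)
      = normalOrderedCoeff m (y - 2 * m) (normalOrderedCoeff m x f) := by
  obtain ⟨M, hM, hM'⟩ := exists_natDegree_translation_lt m f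
  rw [normalOrderedCoeff_normalOrderedCoeff m hm _ _ f hM hM',
    normalOrderedCoeff_normalOrderedCoeff m hm _ _ f hM hM', ← Finset.sum_range_reflect]
  refine Finset.sum_congr rfl fun l hl => ?_
  have hl' : l ≤ 2 * m := by
    rw [Finset.mem_range] at hl
    omega
  have h1 : 2 * m + 1 - 1 - l = 2 * m - l := by omega
  -- The reflection l ↦ 2m - l preserves the signed binomials and exchanges the roles of x and y;
  -- the sums over i and j are exchanged as well.
  rw [h1, neg_one_pow_two_mul_sub hl', Nat.choose_symm hl', Finset.sum_comm]
  refine congrArg _ (Finset.sum_congr rfl fun j _ => Finset.sum_congr rfl fun i _ => ?_)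
  have h3 : expAnnihilation m j (expAnnihilation m i f)
      = expAnnihilation m i (expAnnihilation m j f) :=
    LinearMap.congr_fun (commute_expAnnihilation m j i).eq f
  rw [h3, mul_left_comm, show y - ((2 * m - l : ℕ) : ℤ) + i = y - 2 * m + l + i by
      push_cast [Nat.cast_sub hl']; ring,
    show x - 2 * (m : ℤ) + ((2 * m - l : ℕ) : ℤ) + j = x - l + j by
      push_cast [Nat.cast_sub hl']; ring]

lemma mode_single (m : ℕ) (n c : ℤ) (f : Fock) : mode m n (Finsupp.single c f)
    = Finsupp.single (c + 2 * m) (normalOrderedCoeff m (-n - 1 - c) f) := by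
  simp [mode]

/-- A mode raises the charge by 2m, which lowers the index of the next N by 2m: exactly the shift in
`normalOrderedCoeff_comm`. -/
lemma mode_comm (m : ℕ) (hm : 1 ≤ m) (n k : ℤ) : mode m n * mode m k = mode m k * mode m n := by
  refine Finsupp.lhom_ext fun c f => ?_
  simp only [Module.End.mul_apply, mode_single]
  have h := normalOrderedCoeff_comm m hm (-n - 1 - c) (-k - 1 - c) f
  rw [show -n - 1 - (c + 2 * m) = -n - 1 - c - 2 * m by ring,
    show -k - 1 - (c + 2 * m) = -k - 1 - c - 2 * m by ring, h]

/-! ### The quadratic relations -/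

/-- The quadratic element `∑ (α₁)ᵢ (α₂)ᵢ ξ_{α₁} ξ_{α₂}`, the sum over `α₁ + α₂ = s`. -/
def quadraticRelation (i s : ℕ) : MvPolynomial ℕ ℂ :=
  ∑ α ∈ Finset.HasAntidiagonal.antidiagonal s,
    ((α.1.descFactorial i * α.2.descFactorial i : ℕ) : MvPolynomial ℕ ℂ) * (X α.1 * X α.2)

lemma sum_antidiagonal_add_two_mul {M : Type*} [AddCommMonoid M] (f : ℕ → ℕ → M) (i s : ℕ)
    (h1 : ∀ a b, a < i → f a b = 0) (h2 : ∀ a b, b < i → f a b = 0) :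
    ∑ α ∈ Finset.HasAntidiagonal.antidiagonal (s + 2 * i), f α.1 α.2
      = ∑ β ∈ Finset.HasAntidiagonal.antidiagonal s, f (β.1 + i) (β.2 + i) := by
  rw [Finset.Nat.sum_antidiagonal_eq_sum_range_succ f,
    Finset.Nat.sum_antidiagonal_eq_sum_range_succ fun a b => f (a + i) (b + i),
    show (s + 2 * i).succ = i + (s + 1 + i) by omega, Finset.sum_range_add,
    Finset.sum_eq_zero fun x hx => h1 _ _ (Finset.mem_range.1 hx), zero_add,
    Finset.sum_range_add, Finset.sum_eq_zero (s := Finset.range i), add_zero]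
  · refine Finset.sum_congr rfl fun x hx => ?_
    rw [Finset.mem_range] at hx
    congr 1 <;> omega
  · exact fun x hx => h2 _ _ (by rw [Finset.mem_range] at hx; omega)

/-- Each i-fold derivative lowers indices by i, hence the shift by 2i. The terms with some index
below i carry weight zero. -/
lemma coeff_iterate_derivative_sq (i s : ℕ) :
    PowerSeries.coeff s (((PowerSeries.derivative (MvPolynomial ℕ ℂ))^[i] genSeries) ^ 2)
      = quadraticRelation i (s + 2 * i) := by
  rw [quadraticRelation, sum_antidiagonal_add_two_mul (fun a b =>
    ((a.descFactorial i * b.descFactorial i : ℕ) : MvPolynomial ℕ ℂ) * (X a * X b)), pow_two,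
    PowerSeries.coeff_mul]
  · refine Finset.sum_congr rfl fun β _ => ?_
    simp only [PowerSeries.coeff_iterate_derivative, genSeries, PowerSeries.coeff_mk,
      Nat.add_descFactorial_eq_ascFactorial]
    push_cast
    ring
  · intro a b h
    simp [Nat.descFactorial_of_lt h]
  · intro a b h
    simp [Nat.descFactorial_of_lt h]

lemma quadraticRelation_eq_zero {i s : ℕ} (h : s < 2 * i) : quadraticRelation i s = 0 := by
  refine Finset.sum_eq_zero fun α hα => ?_
  rw [Finset.HasAntidiagonal.mem_antidiagonal] at hα
  rcases Nat.lt_or_ge α.1 i with h1 | h1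
  · simp [Nat.descFactorial_of_lt h1]
  · simp [Nat.descFactorial_of_lt (show α.2 < i by omega)]

lemma relationIdeal_eq_span (m : ℕ) : relationIdeal m =
    Ideal.span {r | ∃ i < m, ∃ s : ℕ, r = quadraticRelation i s} := by
  refine le_antisymm (Ideal.span_le.2 ?_) (Ideal.span_le.2 ?_)
  · rintro _ ⟨i, hi, s, rfl⟩
    exact Ideal.subset_span ⟨i, hi, s + 2 * i, coeff_iterate_derivative_sq i s⟩
  · rintro _ ⟨i, hi, s, rfl⟩
    rcases Nat.lt_or_ge s (2 * i) with h | h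
    · rw [quadraticRelation_eq_zero h]
      exact Ideal.zero_mem _
    · refine Ideal.subset_span ⟨i, hi, s - 2 * i, ?_⟩
      rw [coeff_iterate_derivative_sq, Nat.sub_add_cancel h]

/-- Alternating sums of a polynomial of degree `< 2m` with binomial weights vanish. -/
lemma sum_neg_one_pow_choose_eval {m : ℕ} {P : Polynomial ℤ} (hP : P.natDegree < 2 * m) (b : ℤ) :
    ∑ l ∈ Finset.range (2 * m + 1), ((-1 : ℤ) ^ l * (2 * m).choose l) * P.eval (b + l) = 0 := by
  have h := congrFun (Polynomial.fwdDiff_iter_eq_zero_of_degree_lt hP) b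
  rw [fwdDiff_iter_eq_sum_shift, Pi.zero_apply] at h
  rw [← h]
  refine Finset.sum_congr rfl fun l hl => ?_
  rw [neg_one_pow_two_mul_sub (Nat.lt_succ_iff.1 (Finset.mem_range.1 hl))]
  simp

/-- Substitute b = a - l. The vanishing hypotheses discard both ends, so the range does not depend
on l. -/
lemma sum_range_smul_shift {M : Type*} [AddCommGroup M] (W : ℤ → ℤ) (H : ℤ → M) (s l : ℕ)
    (h1 : ∀ b < 0, H b = 0) (h2 : ∀ b : ℤ, (s : ℤ) < b + l → H b = 0) :
    ∑ a ∈ Finset.range (s + 1), W a • H (a - l)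
      = ∑ b ∈ Finset.range (s + 1), W (b + l) • H b := by
  have e : ∑ a ∈ Finset.range (s + 1), W a • H (a - l)
      = ∑ a ∈ Finset.range (s + 1 + l), W a • H (a - l) := by
    rw [Finset.sum_range_add _ (s + 1) l, left_eq_add]
    exact Finset.sum_eq_zero fun x _ => by rw [h2 _ (by push_cast; omega), smul_zero]
  rw [e, add_comm, Finset.sum_range_add, Finset.sum_eq_zero, zero_add]
  · refine Finset.sum_congr rfl fun x _ => ?_
    rw [Nat.cast_add, add_sub_cancel_left, add_comm (l : ℤ)]
  · intro x hx
    rw [Finset.mem_range] at hx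
    rw [h1 _ (by omega), smul_zero]

lemma natDegree_descPochhammer_mul_comp_lt {m i : ℕ} (hi : i < m) (s : ℤ) :
    (descPochhammer ℤ i * (descPochhammer ℤ i).comp (Polynomial.C s - Polynomial.X)).natDegree
      < 2 * m := by
  have h1 : (descPochhammer ℤ i).natDegree = i := descPochhammer_natDegree ℤ i
  have h2 : (Polynomial.C s - Polynomial.X : Polynomial ℤ).natDegree ≤ 1 := by compute_degree
  have h3 := Polynomial.natDegree_comp_le (p := descPochhammer ℤ i)
    (q := Polynomial.C s - Polynomial.X)
  have h4 := Polynomial.natDegree_mul_le (p := descPochhammer ℤ i)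
    (q := (descPochhammer ℤ i).comp (Polynomial.C s - Polynomial.X))
  rw [h1] at h3 h4
  have := Nat.mul_le_mul_left i h2
  omega

/-- By the product formula, after reindexing by b = a - l, the coefficient of Q_b Q_{s-2m-b} is the
2m-th difference at b of P(x) = (x)ᵢ(s - x)ᵢ, whose degree is below 2m. -/
lemma sum_descFactorial_smul_normalOrderedCoeff {m i : ℕ} (hi : i < m) (s : ℕ) :
    ∑ a ∈ Finset.range (s + 1), (a.descFactorial i * (s - a).descFactorial i) •
      normalOrderedCoeff m (((s - a : ℕ) : ℤ) - 2 * m) (schurInt m a) = 0 := by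
  set P := descPochhammer ℤ i * (descPochhammer ℤ i).comp (Polynomial.C (s : ℤ) - Polynomial.X)
    with hP
  set H : ℤ → Fock := fun b => schurInt m b * schurInt m (s - 2 * m - b) with hH
  have h1 : ∀ a ∈ Finset.range (s + 1), (a.descFactorial i * (s - a).descFactorial i) •
      normalOrderedCoeff m (((s - a : ℕ) : ℤ) - 2 * m) (schurInt m a)
      = ∑ l ∈ Finset.range (2 * m + 1), ((-1 : ℤ) ^ l * (2 * m).choose l) •
        (P.eval (a : ℤ) • H (a - l)) := by
    intro a ha
    have ha' : a ≤ s := Nat.lt_succ_iff.1 (Finset.mem_range.1 ha)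
    have hE : ((a.descFactorial i * (s - a).descFactorial i : ℕ) : ℤ) = P.eval (a : ℤ) := by
      rw [hP, Polynomial.eval_mul, Polynomial.eval_comp, Polynomial.eval_sub, Polynomial.eval_C,
        Polynomial.eval_X, ← Nat.cast_sub ha', descPochhammer_eval_eq_descFactorial,
        descPochhammer_eval_eq_descFactorial, Nat.cast_mul]
    rw [← mul_one (schurInt m a), normalOrderedCoeff_schurInt_mul m (by omega), Finset.smul_sum]
    refine Finset.sum_congr rfl fun l _ => ?_
    rw [smul_comm, normalOrderedCoeff_one, ← hE, natCast_zsmul, hH]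
    simp only
    rw [show ((s - a : ℕ) : ℤ) - 2 * m + l = s - 2 * m - (a - l) by
      push_cast [Nat.cast_sub ha']; ring]
  rw [Finset.sum_congr rfl h1, Finset.sum_comm]
  have h2 : ∀ l ∈ Finset.range (2 * m + 1), ∑ a ∈ Finset.range (s + 1),
      ((-1 : ℤ) ^ l * (2 * m).choose l) • (P.eval (a : ℤ) • H (a - l))
      = ∑ b ∈ Finset.range (s + 1),
        (((-1 : ℤ) ^ l * (2 * m).choose l) * P.eval ((b : ℤ) + l)) • H b := by
    intro l hl
    rw [Finset.mem_range] at hl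
    rw [← Finset.smul_sum, sum_range_smul_shift (fun x => P.eval x) H s l, Finset.smul_sum]
    · simp only [smul_smul]
    · intro b hb
      simp only [hH, schurInt_of_neg m hb, zero_mul]
    · intro b hb
      simp only [hH]
      -- Since l ≤ 2m, the assumption s < b + l makes the second index negative.
      rw [schurInt_of_neg m (show (s : ℤ) - 2 * m - b < 0 by omega), mul_zero]
  rw [Finset.sum_congr rfl h2, Finset.sum_comm]
  refine Finset.sum_eq_zero fun b _ => ?_
  rw [← Finset.sum_smul,
    sum_neg_one_pow_choose_eval (natDegree_descPochhammer_mul_comp_lt hi (s : ℤ)), zero_smul]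

/-! ### The polynomial ring acting on v_p -/

-- `aeval` needs a commutative target; the subalgebra generated by a commuting family is one.
open scoped IsMulCommutative in
lemma exists_aeval_of_commute {σ R A : Type*} [CommRing R] [Ring A] [Algebra R A] (x : σ → A)
    (h : ∀ i j, x i * x j = x j * x i) :
    ∃ Φ : MvPolynomial σ R →ₐ[R] A, ∀ j, Φ (X j) = x j := by
  have : IsMulCommutative (Algebra.adjoin R (Set.range x)) := Algebra.isMulCommutative_adjoin R (by
    rintro _ ⟨a, rfl⟩ _ ⟨b, rfl⟩
    exact h a b)
  refine ⟨(Algebra.adjoin R (Set.range x)).val.comp (aeval fun j =>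
    (⟨x j, Algebra.subset_adjoin ⟨_, rfl⟩⟩ : Algebra.adjoin R (Set.range x))), fun j => ?_⟩
  simp

/-- The action of `ℂ[ξ₀, ξ₁, …]` where `ξⱼ` acts as the mode `a_{p-1-j}`. -/
lemma exists_modeAction (m : ℕ) (hm : 1 ≤ m) (p : ℤ) :
    ∃ Φ : MvPolynomial ℕ ℂ →ₐ[ℂ] Module.End ℂ FockSum, ∀ j : ℕ, Φ (X j) = mode m (p - 1 - j) :=
  exists_aeval_of_commute (fun j : ℕ => mode m (p - 1 - j)) fun _ _ => mode_comm m hm _ _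

/-- The homomorphism `ℂ[ξ₀, ξ₁, …] → End` sending `ξⱼ` to the mode `a_{p-1-j}`. -/
def modeAction (m : ℕ) (hm : 1 ≤ m) (p : ℤ) : MvPolynomial ℕ ℂ →ₐ[ℂ] Module.End ℂ FockSum :=
  (exists_modeAction m hm p).choose

lemma modeAction_X (m : ℕ) (hm : 1 ≤ m) (p : ℤ) (j : ℕ) :
    modeAction m hm p (X j) = mode m (p - 1 - j) :=
  (exists_modeAction m hm p).choose_spec j

lemma range_modeAction (m : ℕ) (hm : 1 ≤ m) (p : ℤ) :
    (modeAction m hm p).range = Algebra.adjoin ℂ (mode m '' Set.Iic (p - 1)) := by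
  rw [← Algebra.map_top, ← MvPolynomial.adjoin_range_X, AlgHom.map_adjoin]
  congr 1
  ext T
  constructor
  · rintro ⟨_, ⟨j, rfl⟩, rfl⟩
    exact ⟨p - 1 - j, Set.mem_Iic.2 (sub_le_self _ (Nat.cast_nonneg j)),
      (modeAction_X m hm p j).symm⟩
  · rintro ⟨n, hn, rfl⟩
    rw [Set.mem_Iic] at hn
    refine ⟨_, ⟨(p - 1 - n).toNat, rfl⟩, ?_⟩
    rw [modeAction_X]
    congr 1
    omega

/-- The map `f ↦ f(a_{p-1}, a_{p-2}, …) v_p`. -/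
def orbitMap (m : ℕ) (hm : 1 ≤ m) (p : ℤ) : MvPolynomial ℕ ℂ →ₗ[ℂ] FockSum :=
  LinearMap.applyₗ (extremalVector p) ∘ₗ (modeAction m hm p).toLinearMap

lemma orbitMap_apply (m : ℕ) (hm : 1 ≤ m) (p : ℤ) (f : MvPolynomial ℕ ℂ) :
    orbitMap m hm p f = modeAction m hm p f (extremalVector p) := rfl

lemma range_orbitMap (m : ℕ) (hm : 1 ≤ m) (p : ℤ) :
    LinearMap.range (orbitMap m hm p) = principalSubspace m p := by
  rw [orbitMap, LinearMap.range_comp, principalSubspace, ← range_modeAction m hm p]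
  rfl

lemma orbitMap_X_mul (m : ℕ) (hm : 1 ≤ m) (p : ℤ) (j : ℕ) (f : MvPolynomial ℕ ℂ) :
    orbitMap m hm p (X j * f) = mode m (p - 1 - j) (orbitMap m hm p f) := by
  rw [orbitMap_apply, map_mul, modeAction_X]
  rfl

lemma orbitMap_one (m : ℕ) (hm : 1 ≤ m) (p : ℤ) :
    orbitMap m hm p 1 = extremalVector p := by
  rw [orbitMap_apply, map_one, Module.End.one_apply]

lemma orbitMap_quadraticRelation {m i : ℕ} (hm : 1 ≤ m) (hi : i < m) (p : ℤ) (s : ℕ) :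
    orbitMap m hm p (quadraticRelation i s) = 0 := by
  rw [quadraticRelation, map_sum]
  have h : ∀ α : ℕ × ℕ, orbitMap m hm p
      (((α.1.descFactorial i * α.2.descFactorial i : ℕ) : MvPolynomial ℕ ℂ) * (X α.1 * X α.2))
      = Finsupp.singleAddHom (-p + 2 * m + 2 * m) ((α.1.descFactorial i * α.2.descFactorial i) •
        normalOrderedCoeff m ((α.2 : ℤ) - 2 * m) (schurInt m α.1)) := by
    intro α
    rw [← nsmul_eq_mul, map_nsmul, mul_comm (X α.1), orbitMap_X_mul, ← mul_one (X α.1),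
      orbitMap_X_mul, orbitMap_one, extremalVector, mode_single, mode_single, map_nsmul,
      show -(p - 1 - (α.1 : ℤ)) - 1 - -p = α.1 by ring,
      show -(p - 1 - (α.2 : ℤ)) - 1 - (-p + 2 * m) = α.2 - 2 * m by ring, normalOrderedCoeff_one]
    rfl
  rw [Finset.sum_congr rfl fun α _ => h α, ← map_sum,
    Finset.Nat.sum_antidiagonal_eq_sum_range_succ (fun a b => (a.descFactorial i *
      b.descFactorial i) • normalOrderedCoeff m ((b : ℤ) - 2 * m) (schurInt m a)),
    sum_descFactorial_smul_normalOrderedCoeff hi, map_zero]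

lemma relationIdeal_le_ker_orbitMap (m : ℕ) (hm : 1 ≤ m) (p : ℤ) {f : MvPolynomial ℕ ℂ}
    (hf : f ∈ relationIdeal m) : orbitMap m hm p f = 0 := by
  rw [relationIdeal_eq_span] at hf
  induction hf using Submodule.span_induction with
  | mem x hx =>
    obtain ⟨i, hi, s, rfl⟩ := hx
    exact orbitMap_quadraticRelation hm hi p s
  | zero => exact map_zero _
  | add x y _ _ hx hy => rw [map_add, hx, hy, add_zero]
  | smul a x _ hx =>
    rw [smul_eq_mul, orbitMap_apply, map_mul, Module.End.mul_apply, ← orbitMap_apply, hx, map_zero]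

/-! ### Leading monomials in the coordinates Qₙ -/

/-- The exponent of the variable `yₙ`, with the convention `y₀ = 1`. -/
def varExponent : ℕ → ℕ+ →₀ ℕ
  | 0 => 0
  | n + 1 => Finsupp.single n.succPNat 1

/-- The variable `yₙ`, with the convention `y₀ = 1`. -/
def var (n : ℕ) : Fock := monomial (varExponent n) 1

/-- The expression of `h₋₍ₙ₊₁₎` as a polynomial in `y₁, y₂, …`, where `yᵢ` stands for `Qᵢ`. -/
def powerSum (m : ℕ) : ℕ → Fock
  | n => C ((Real.sqrt (2 * m) : ℂ)⁻¹ * ((n + 1 : ℕ) : ℂ)) * var (n + 1)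
      - ∑ a : Fin n, powerSum m a * var (n - a)
decreasing_by exact a.2

/-- The homomorphism expressing elements of the Fock space as polynomials in `Q₁, Q₂, …`. -/
def schurCoord (m : ℕ) : Fock →ₐ[ℂ] Fock := aeval fun k : ℕ+ => powerSum m k.natPred

lemma schurCoord_X (m n : ℕ) : schurCoord m (X n.succPNat) = powerSum m n := by
  simp [schurCoord]

/-- `powerSum` is Newton's recursion solved for h₋₍ₙ₊₁₎, so substituting it back returns yₙ.
Bijectivity of `schurCoord` is not needed: coefficients after applying it already detect
independence. -/
lemma schurCoord_schur (m : ℕ) (hm : 1 ≤ m) (n : ℕ) : schurCoord m (schur m n) = var n := by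
  induction n using Nat.strong_induction_on with
  | _ n ih =>
    rcases n with _ | n
    · rw [schur_zero, map_one]
      rfl
    · have h := congrArg (schurCoord m) (schur_succ m n)
      have hr : (Real.sqrt (2 * m) : ℂ) ≠ 0 := by
        rw [Complex.ofReal_ne_zero, Real.sqrt_ne_zero']
        have : (0 : ℝ) < m := by exact_mod_cast hm
        linarith
      have hne : ((n : Fock) + 1) ≠ 0 := Nat.cast_add_one_ne_zero n
      rw [map_mul, map_add, map_natCast, map_one, map_sum] at h
      have h2 : ∀ y ∈ Finset.HasAntidiagonal.antidiagonal n,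
          schurCoord m ((Real.sqrt (2 * m) : ℂ) • (X y.1.succPNat * schur m y.2))
            = (Real.sqrt (2 * m) : ℂ) • (powerSum m y.1 * var y.2) := by
        intro y hy
        rw [Finset.HasAntidiagonal.mem_antidiagonal] at hy
        rw [map_smul, map_mul, schurCoord_X, ih y.2 (by omega)]
      rw [Finset.sum_congr rfl h2, ← Finset.smul_sum,
        Finset.Nat.sum_antidiagonal_eq_sum_range_succ fun a b => powerSum m a * var b,
        Finset.sum_range_succ, Nat.sub_self, Finset.sum_range, powerSum] at h
      have h3 : (var 0 : Fock) = 1 := rfl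
      rw [h3, mul_one, add_sub_cancel, ← MvPolynomial.smul_eq_C_mul, smul_smul, ← mul_assoc,
        mul_inv_cancel₀ hr, one_mul, MvPolynomial.smul_eq_C_mul, map_natCast, mul_comm] at h
      refine mul_left_cancel₀ hne ?_
      rw [h, Nat.cast_succ]

lemma coeff_add_var_mul (μ : ℕ+ →₀ ℕ) (n : ℕ) (g : Fock) :
    coeff (μ + varExponent n) (var n * g) = coeff μ g := by
  rw [add_comm, var, coeff_monomial_mul, one_mul]

lemma coeff_var_mul_eq_zero {μ : ℕ+ →₀ ℕ} {n k : ℕ} (hμ : ∀ i : ℕ+, n < i → μ i = 0) (h : n < k)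
    (g : Fock) : coeff μ (var k * g) = 0 := by
  rw [var, coeff_monomial_mul', if_neg]
  intro hle
  obtain ⟨k, rfl⟩ : ∃ l, k = l + 1 := ⟨k - 1, by omega⟩
  have h1 := hle k.succPNat
  rw [hμ k.succPNat (by simpa using h), varExponent, Finsupp.single_eq_same] at h1
  omega

lemma expAnnihilation_zero (m : ℕ) (f : Fock) : expAnnihilation m 0 f = f := by
  rw [expAnnihilation, constantCoeff_formalExp, Module.End.one_apply]

/-- The annihilation term j = 0 is the identity and gives y_k; every other term contains a variable
of larger index. -/
lemma schurCoord_normalOrderedCoeff (m : ℕ) (hm : 1 ≤ m) (k : ℕ) (f : Fock) :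
    ∃ (M : ℕ) (g : ℕ → Fock), schurCoord m (normalOrderedCoeff m k f)
      = var k * schurCoord m f + ∑ j ∈ Finset.range M, var (k + (j + 1)) * g j := by
  refine ⟨(translation m f).natDegree, fun j => schurCoord m (expAnnihilation m (j + 1) f), ?_⟩
  rw [normalOrderedCoeff_eq_sum m k f (Nat.lt_succ_self _), map_sum, Finset.sum_range_succ',
    add_comm]
  congr 1
  · rw [expAnnihilation_zero, ← Nat.cast_add, schurInt_natCast, map_mul, schurCoord_schur m hm,
      add_zero]
  · refine Finset.sum_congr rfl fun j _ => ?_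
    rw [← Nat.cast_add, schurInt_natCast, map_mul, schurCoord_schur m hm]

lemma coeff_schurCoord_normalOrderedCoeff_of_lt {m : ℕ} (hm : 1 ≤ m) {μ : ℕ+ →₀ ℕ} {n k : ℕ}
    (hμ : ∀ i : ℕ+, n < i → μ i = 0) (h : n < k) (f : Fock) :
    coeff μ (schurCoord m (normalOrderedCoeff m k f)) = 0 := by
  obtain ⟨M, g, e⟩ := schurCoord_normalOrderedCoeff m hm k f
  rw [e, coeff_add, coeff_sum, coeff_var_mul_eq_zero hμ h, zero_add]
  exact Finset.sum_eq_zero fun j _ => coeff_var_mul_eq_zero hμ (by omega) _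

lemma coeff_schurCoord_normalOrderedCoeff_self {m : ℕ} (hm : 1 ≤ m) {μ : ℕ+ →₀ ℕ} {n : ℕ}
    (hμ : ∀ i : ℕ+, n < i → (μ + varExponent n) i = 0) (f : Fock) :
    coeff (μ + varExponent n) (schurCoord m (normalOrderedCoeff m n f))
      = coeff μ (schurCoord m f) := by
  obtain ⟨M, g, e⟩ := schurCoord_normalOrderedCoeff m hm n f
  rw [e, coeff_add, coeff_sum, coeff_add_var_mul, add_eq_left]
  exact Finset.sum_eq_zero fun j _ => coeff_var_mul_eq_zero hμ (by omega) _

/-! ### Independence of the separated monomials -/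

/-- A list is `2m`-separated if each entry exceeds the next one by at least `2m`. -/
def Separated (m : ℕ) (L : List ℕ) : Prop := L.IsChain fun a b => b + 2 * m ≤ a

/-- The component in the Fock space of `a_{p-1-j₁} ⋯ a_{p-1-jₖ} v_p`. -/
def fockVector (m : ℕ) : List ℕ → Fock
  | [] => 1
  | a :: L => normalOrderedCoeff m ((a : ℤ) - 2 * m * L.length) (fockVector m L)

/-- The exponent of the leading monomial in `Q₁, Q₂, …` of `fockVector m L`. -/
def leadingExponent (m : ℕ) : List ℕ → ℕ+ →₀ ℕ
  | [] => 0
  | a :: L => leadingExponent m L + varExponent (a - 2 * m * L.length)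

lemma orbitMap_prod_X (m : ℕ) (hm : 1 ≤ m) (p : ℤ) (L : List ℕ) :
    orbitMap m hm p (L.map X).prod
      = Finsupp.single (-p + 2 * m * L.length) (fockVector m L) := by
  induction L with
  | nil => simp [orbitMap_one, extremalVector, fockVector]
  | cons a L ih =>
    rw [List.map_cons, List.prod_cons, orbitMap_X_mul, ih, mode_single, fockVector,
      List.length_cons]
    rw [show -p + 2 * (m : ℤ) * L.length + 2 * m = -p + 2 * m * ((L.length + 1 : ℕ) : ℤ) by
      push_cast; ring, show -(p - 1 - (a : ℤ)) - 1 - (-p + 2 * m * L.length)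
        = a - 2 * m * L.length by ring]

lemma varExponent_eq_zero {n : ℕ} {i : ℕ+} (h : n < i) : varExponent n i = 0 := by
  rcases n with _ | n
  · rfl
  · rw [varExponent, Finsupp.single_apply, if_neg]
    rintro rfl
    simp at h

/-- Subtracting 2m times the number of later entries turns gaps of at least 2m into a weakly
decreasing sequence of natural numbers. So truncated subtraction is harmless, and the head gives the
largest variable index. -/
lemma Separated.bounds {m a : ℕ} {L : List ℕ} (h : Separated m (a :: L)) :
    2 * m * L.length ≤ a ∧
      ∀ i : ℕ+, a - 2 * m * L.length < i → leadingExponent m (a :: L) i = 0 := by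
  induction L generalizing a with
  | nil =>
    refine ⟨by simp, fun i hi => ?_⟩
    rw [leadingExponent, Finsupp.add_apply, varExponent_eq_zero hi]
    rfl
  | cons b L ih =>
    rw [Separated, List.isChain_cons_cons] at h
    obtain ⟨h1, h2⟩ := ih h.2
    have h3 := h.1
    rw [List.length_cons, mul_add, mul_one]
    refine ⟨by omega, fun i hi => ?_⟩
    rw [leadingExponent, Finsupp.add_apply, h2 i (by omega), zero_add, List.length_cons, mul_add,
      mul_one, varExponent_eq_zero hi]

/-- Triangularity of the vectors `fockVector m L` for separated lists of the same length. -/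
lemma coeff_leadingExponent {m : ℕ} (hm : 1 ≤ m) {L L' : List ℕ} (hL : Separated m L)
    (hL' : Separated m L') (hlen : L.length = L'.length) (hle : L ≤ L') :
    coeff (leadingExponent m L) (schurCoord m (fockVector m L')) = if L = L' then 1 else 0 := by
  induction L generalizing L' with
  | nil =>
    obtain rfl : L' = [] := List.length_eq_zero_iff.1 hlen.symm
    rw [if_pos rfl, fockVector, map_one, leadingExponent, coeff_zero_one]
  | cons a L ih =>
    obtain _ | ⟨a', L'⟩ := L'
    · simp at hlen
    have hlen' : L.length = L'.length := by simpa using hlen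
    obtain ⟨h1, h2⟩ := hL.bounds
    obtain ⟨h1', -⟩ := hL'.bounds
    rw [fockVector, ← hlen', show (a' : ℤ) - 2 * m * L.length = ((a' - 2 * m * L.length : ℕ) : ℤ) by
      rw [Nat.cast_sub (hlen' ▸ h1')]; push_cast; ring]
    rcases lt_trichotomy a a' with hlt | rfl | hlt
    · rw [← hlen'] at h1'
      rw [coeff_schurCoord_normalOrderedCoeff_of_lt hm h2 (by omega), if_neg]
      intro h
      injection h with h
      omega
    · rw [leadingExponent, coeff_schurCoord_normalOrderedCoeff_self hm h2,
        ih (L' := L') hL.tail hL'.tail hlen' (not_lt.1 fun h => not_lt.2 hle (List.Lex.cons h))]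
      simp
    · exact absurd (List.Lex.rel hlt) (not_lt.2 hle)

/-- The span of the separated monomials. -/
def separatedSpan (m : ℕ) : Submodule ℂ (MvPolynomial ℕ ℂ) :=
  Submodule.span ℂ ((fun L : List ℕ => (L.map X).prod) '' {L | Separated m L})

lemma eq_zero_of_orbitMap_eq_zero (m : ℕ) (hm : 1 ≤ m) (p : ℤ) {f : MvPolynomial ℕ ℂ}
    (hf : f ∈ separatedSpan m) (h : orbitMap m hm p f = 0) : f = 0 := by
  rw [separatedSpan, Finsupp.mem_span_image_iff_linearCombination] at hf
  obtain ⟨c, hc, rfl⟩ := hf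
  suffices c = 0 by rw [this, map_zero]
  by_contra hne
  have hs : c.support.Nonempty := Finsupp.support_nonempty_iff.2 hne
  -- For the lexicographically least list in the support, triangularity removes every other list of
  -- the same length; lists of other lengths lie in other charges.
  set L := c.support.min' hs
  have hLs : L ∈ c.support := c.support.min'_mem hs
  have hL : Separated m L := hc hLs
  refine Finsupp.mem_support_iff.1 hLs ?_
  rw [Finsupp.linearCombination_apply, Finsupp.sum, map_sum] at h
  have h2 := congrArg (fun v : FockSum =>
    coeff (leadingExponent m L) (schurCoord m (v (-p + 2 * m * L.length)))) h
  simp only [map_smul, orbitMap_prod_X, Finsupp.coe_zero, Pi.zero_apply, map_zero, coeff_zero,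
    Finsupp.finsetSum_apply, map_sum, coeff_sum, Finsupp.smul_apply, coeff_smul] at h2
  rw [Finset.sum_eq_single L] at h2
  · rwa [Finsupp.single_eq_same, coeff_leadingExponent hm hL hL rfl le_rfl, if_pos rfl,
      smul_eq_mul, mul_one] at h2
  · intro L' hL's hne'
    by_cases hlen : L.length = L'.length
    · rw [← hlen, Finsupp.single_eq_same, coeff_leadingExponent hm hL (hc hL's) hlen
        (c.support.min'_le L' hL's), if_neg (Ne.symm hne'), smul_zero]
    · rw [Finsupp.single_eq_of_ne, map_zero, coeff_zero, smul_zero]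
      intro h
      have h' : (2 * m : ℤ) * L.length = 2 * m * L'.length := by linarith
      have : (2 * m : ℤ) ≠ 0 := by positivity
      exact hlen (by exact_mod_cast mul_left_cancel₀ this h')
  · exact fun h => absurd hLs h

/-! ### Separated monomials span modulo the relations -/

/-- A submodule containing a monic polynomial of each degree below `m` contains all polynomials of
degree below `m`. -/
lemma mem_of_degree_lt {W : Submodule ℂ (Polynomial ℂ)} {m : ℕ} {q : ℕ → Polynomial ℂ}
    (hq : ∀ i < m, (q i).Monic ∧ (q i).natDegree = i ∧ q i ∈ W) {u : Polynomial ℂ}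
    (hu : u.degree < m) : u ∈ W := by
  suffices ∀ n ≤ m, ∀ u : Polynomial ℂ, u.degree < n → u ∈ W from this m le_rfl u hu
  intro n
  induction n with
  | zero =>
    intro _ u hu
    rw [Polynomial.degree_lt_iff_coeff_zero] at hu
    have : u = 0 := Polynomial.ext fun k => hu k (Nat.zero_le k)
    rw [this]
    exact W.zero_mem
  | succ n ih =>
    intro hn u hu
    obtain ⟨h1, h2, h3⟩ := hq n hn
    have h4 : u - u.coeff n • q n ∈ W := by
      refine ih (Nat.le_of_succ_le hn) _ ?_
      rw [Polynomial.degree_lt_iff_coeff_zero] at hu ⊢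
      intro k hk
      rw [Polynomial.coeff_sub, Polynomial.coeff_smul, smul_eq_mul]
      rcases hk.eq_or_lt with rfl | hk
      · have h5 : (q n).coeff n = 1 := by
          rw [Polynomial.Monic, Polynomial.leadingCoeff, h2] at h1
          exact h1
        rw [h5, mul_one, sub_self]
      · rw [hu k hk, Polynomial.coeff_eq_zero_of_natDegree_lt (by omega : (q n).natDegree < k),
          mul_zero, sub_zero]
    have := W.add_mem h4 (W.smul_mem (u.coeff n) h3)
    rwa [sub_add_cancel] at this

/-- The quadratic element `∑ u(α₁ α₂) ξ_{α₁} ξ_{α₂}`, the sum over `α₁ + α₂ = s`. -/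
def weightedQuadratic (s : ℕ) : Polynomial ℂ →ₗ[ℂ] MvPolynomial ℕ ℂ :=
  ∑ α ∈ Finset.HasAntidiagonal.antidiagonal s,
    (Polynomial.leval ((α.1 * α.2 : ℕ) : ℂ)).smulRight (X α.1 * X α.2)

lemma weightedQuadratic_apply (s : ℕ) (u : Polynomial ℂ) : weightedQuadratic s u
    = ∑ α ∈ Finset.HasAntidiagonal.antidiagonal s,
      u.eval ((α.1 * α.2 : ℕ) : ℂ) • (X α.1 * X α.2 : MvPolynomial ℕ ℂ) := by
  rw [weightedQuadratic, LinearMap.sum_apply]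
  rfl

lemma weightedQuadratic_mem {m s : ℕ} {u : Polynomial ℂ} (hu : u.degree < m) :
    weightedQuadratic s u ∈ (relationIdeal m).restrictScalars ℂ := by
  refine mem_of_degree_lt (W := ((relationIdeal m).restrictScalars ℂ).comap (weightedQuadratic s))
    -- With α₁ + α₂ = s one has (α₁ - r)(α₂ - r) = α₁α₂ - (rs - r²).
    (q := fun i => ∏ r ∈ Finset.range i, (Polynomial.X - Polynomial.C ((r : ℂ) * s - r ^ 2)))
    (fun i hi => ⟨Polynomial.monic_prod_X_sub_C _ _, ?_, ?_⟩) hu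
  · rw [Polynomial.natDegree_finsetProd_X_sub_C_eq_card, Finset.card_range]
  · rw [Submodule.mem_comap, Submodule.restrictScalars_mem, relationIdeal_eq_span]
    refine Ideal.subset_span ⟨i, hi, s, ?_⟩
    rw [weightedQuadratic_apply, quadraticRelation]
    refine Finset.sum_congr rfl fun α hα => ?_
    rw [Finset.HasAntidiagonal.mem_antidiagonal] at hα
    rw [← nsmul_eq_mul, ← Nat.cast_smul_eq_nsmul ℂ]
    congr 1
    rw [Nat.cast_mul, Nat.cast_mul, ← descPochhammer_eval_eq_descFactorial,
      ← descPochhammer_eval_eq_descFactorial, descPochhammer_eval_eq_prod_range,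
      descPochhammer_eval_eq_prod_range, ← Finset.prod_mul_distrib, Polynomial.eval_prod]
    refine Finset.prod_congr rfl fun r _ => ?_
    rw [Polynomial.eval_sub, Polynomial.eval_X, Polynomial.eval_C, ← hα]
    push_cast
    ring

/-- The span of the products `ξ_c ξ_d` with `c + d = s` and `c`, `d` at distance at least `2m`. -/
def farSpan (m s : ℕ) : Submodule ℂ (MvPolynomial ℕ ℂ) :=
  Submodule.span ℂ {r | ∃ c d, c + d = s ∧ d + 2 * m ≤ c ∧ r = X c * X d}

lemma X_mul_X_mem {m a b : ℕ} (hab : a ≤ b) (hb : b < a + 2 * m) :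
    (X a * X b : MvPolynomial ℕ ℂ)
      ∈ (relationIdeal m).restrictScalars ℂ ⊔ farSpan m (a + b) := by
  set s := a + b with hs
  -- The smaller members of the close pairs of sum s. There are at most m, so a polynomial u of
  -- degree < m in the product can vanish at all of them but a.
  set T := (Finset.range (s / 2 + 1)).filter fun c => s < 2 * c + 2 * m with hT
  have hTcard : T.card ≤ m := by
    have h : T ⊆ Finset.Ico (s / 2 + 1 - m) (s / 2 + 1) := by
      intro c hc
      rw [hT, Finset.mem_filter, Finset.mem_range] at hc
      rw [Finset.mem_Ico]
      omega
    have := Finset.card_le_card h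
    rw [Nat.card_Ico] at this
    omega
  have haT : a ∈ T := by
    rw [hT, Finset.mem_filter, Finset.mem_range]
    omega
  set u : Polynomial ℂ := ∏ c ∈ T.erase a, (Polynomial.X - Polynomial.C ((c * (s - c) : ℕ) : ℂ))
    with hu
  have hdeg : u.degree < m := by
    have h1 := Finset.card_erase_lt_of_mem haT
    refine lt_of_le_of_lt Polynomial.degree_le_natDegree ?_
    rw [hu, Polynomial.natDegree_finsetProd_X_sub_C_eq_card]
    exact_mod_cast (by omega : (T.erase a).card < m)
  have hu0 : ∀ c ∈ T, c ≠ a → u.eval ((c * (s - c) : ℕ) : ℂ) = 0 := by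
    intro c hc hca
    rw [hu, Polynomial.eval_prod]
    exact Finset.prod_eq_zero (Finset.mem_erase.2 ⟨hca, hc⟩) (by simp)
  have hu1 : u.eval ((a * b : ℕ) : ℂ) ≠ 0 := by
    rw [hu, Polynomial.eval_prod, Finset.prod_ne_zero_iff]
    intro c hc
    rw [Finset.mem_erase, hT, Finset.mem_filter, Finset.mem_range] at hc
    rw [Polynomial.eval_sub, Polynomial.eval_X, Polynomial.eval_C, sub_ne_zero,
      Nat.cast_injective.ne_iff]
    obtain ⟨d, hd⟩ : ∃ d, s = c + d := ⟨s - c, by omega⟩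
    rw [hd, Nat.add_sub_cancel_left]
    intro h
    -- Pairs with equal sum and equal product coincide, so the interpolation nodes are distinct from
    -- ab.
    have hz : ((c : ℤ) - a) * ((c : ℤ) - b) = 0 := by
      have h1 : (a : ℤ) * b = c * d := by exact_mod_cast h
      have h2 : (a : ℤ) + b = c + d := by exact_mod_cast hs.symm.trans hd
      linear_combination h1 - (c : ℤ) * h2
    rcases mul_eq_zero.1 hz with h | h <;> omega
  have hmem := Submodule.mem_sup_left (T := farSpan m s) (weightedQuadratic_mem (s := s) hdeg)
  rw [weightedQuadratic_apply, ← Finset.sum_filter_add_sum_filter_not _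
    fun α : ℕ × ℕ => α = (a, b) ∨ α = (b, a)] at hmem
  set V := (relationIdeal m).restrictScalars ℂ ⊔ farSpan m s
  set F := (Finset.HasAntidiagonal.antidiagonal s).filter fun α : ℕ × ℕ => α = (a, b) ∨ α = (b, a)
    with hF
  have hrest : ∑ α ∈ (Finset.HasAntidiagonal.antidiagonal s).filter
      (fun α : ℕ × ℕ => ¬(α = (a, b) ∨ α = (b, a))),
      u.eval ((α.1 * α.2 : ℕ) : ℂ) • (X α.1 * X α.2 : MvPolynomial ℕ ℂ) ∈ V := by
    refine V.sum_mem fun α hα => ?_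
    obtain ⟨c, d⟩ := α
    rw [Finset.mem_filter, Finset.HasAntidiagonal.mem_antidiagonal] at hα
    obtain ⟨hcd, hne⟩ := hα
    simp only [Prod.mk.injEq] at hne hcd ⊢
    have key : ∀ c d : ℕ, c + d = s → c ≤ d → c ≠ a →
        u.eval ((c * d : ℕ) : ℂ) • (X c * X d : MvPolynomial ℕ ℂ) ∈ V := by
      intro c d hcd hle hca
      rcases Nat.lt_or_ge s (2 * c + 2 * m) with h | h
      · have hcT : c ∈ T := by
          rw [hT, Finset.mem_filter, Finset.mem_range]
          omega
        have := hu0 c hcT hca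
        rw [show s - c = d by omega] at this
        rw [this, zero_smul]
        exact V.zero_mem
      · refine V.smul_mem _ (Submodule.mem_sup_right (Submodule.subset_span ?_))
        exact ⟨d, c, by omega, by omega, mul_comm _ _⟩
    rcases le_total c d with h | h
    · exact key c d hcd h fun hca => hne (Or.inl ⟨hca, by omega⟩)
    · rw [mul_comm c, mul_comm (X c)]
      exact key d c (by omega) h fun hda => hne (Or.inr ⟨by omega, hda⟩)
  have hmain : ∑ α ∈ F, u.eval ((α.1 * α.2 : ℕ) : ℂ) • (X α.1 * X α.2 : MvPolynomial ℕ ℂ)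
      = ((F.card : ℂ) * u.eval ((a * b : ℕ) : ℂ)) • (X a * X b) := by
    rw [mul_smul, Nat.cast_smul_eq_nsmul, ← Finset.sum_const]
    refine Finset.sum_congr rfl fun α hα => ?_
    rw [hF, Finset.mem_filter] at hα
    rcases hα.2 with rfl | rfl
    · rfl
    · rw [mul_comm b, mul_comm (X b)]
  -- The cardinality is 1 if a = b and 2 otherwise.
  have hcard : (F.card : ℂ) ≠ 0 := by
    rw [Nat.cast_ne_zero, Finset.card_ne_zero]
    exact ⟨(a, b), by
      rw [hF, Finset.mem_filter, Finset.HasAntidiagonal.mem_antidiagonal]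
      exact ⟨rfl, Or.inl rfl⟩⟩
  have h1 := V.sub_mem hmem hrest
  rw [add_sub_cancel_right, hmain] at h1
  exact (V.smul_mem_iff (mul_ne_zero hcard hu1)).1 h1

lemma sum_sq_le_sq_sum (s : Multiset ℕ) : (s.map (· ^ 2)).sum ≤ s.sum ^ 2 := by
  induction s using Multiset.induction_on with
  | empty => simp
  | cons a s ih =>
    rw [Multiset.map_cons, Multiset.sum_cons, Multiset.sum_cons]
    nlinarith [Nat.zero_le (a * s.sum)]

/-- Every monomial is congruent modulo the relations to a combination of separated monomials. -/
lemma prod_X_mem (m : ℕ) (s : Multiset ℕ) : (s.map X).prod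
    ∈ (relationIdeal m).restrictScalars ℂ ⊔ separatedSpan m := by
  -- Replacing a close pair by a distant one of the same sum increases the sum of squares, which is
  -- bounded by the square of the sum; this deficit therefore decreases.
  induction hN : s.sum ^ 2 - (s.map (· ^ 2)).sum using Nat.strong_induction_on generalizing s with
  | _ N ih =>
  subst hN
  set V := (relationIdeal m).restrictScalars ℂ ⊔ separatedSpan m
  set L := s.sort (· ≥ ·) with hL
  have hLs : (L : Multiset ℕ) = s := s.sort_eq (· ≥ ·)
  by_cases hsep : Separated m L
  · refine Submodule.mem_sup_right (Submodule.subset_span ⟨L, hsep, ?_⟩)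
    rw [← hLs, Multiset.map_coe, Multiset.prod_coe]
  · rw [Separated, List.isChain_iff_forall_rel_of_append_cons_cons] at hsep
    push Not at hsep
    obtain ⟨b, a, l₁, l₂, h, hab⟩ := hsep
    have hle : a ≤ b := by
      have hp : L.Pairwise (· ≥ ·) := s.pairwise_sort (· ≥ ·)
      rw [h, List.pairwise_append] at hp
      exact List.rel_of_pairwise_cons hp.2.1 (by simp)
    set t : Multiset ℕ := ((l₁ ++ l₂ : List ℕ) : Multiset ℕ) with ht
    have hs : s = a ::ₘ b ::ₘ t := by
      rw [← hLs, h, ht, Multiset.cons_swap, Multiset.cons_coe, Multiset.cons_coe,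
        Multiset.coe_eq_coe]
      exact List.perm_append_comm.trans (by
        simp only [List.cons_append]
        exact ((List.perm_append_comm).cons _).cons _)
    have hprod : ∀ c d : ℕ, (((c ::ₘ d ::ₘ t).map X).prod : MvPolynomial ℕ ℂ)
        = (X c * X d) * (t.map X).prod := by
      intro c d
      simp [mul_assoc]
    have hsub : (relationIdeal m).restrictScalars ℂ ⊔ farSpan m (a + b)
        ≤ V.comap (LinearMap.mulRight ℂ (t.map X).prod) := by
      refine sup_le ?_ (Submodule.span_le.2 ?_)
      · intro f hf
        exact Submodule.mem_sup_left ((relationIdeal m).mul_mem_right _ hf)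
      · rintro _ ⟨c, d, hcd, hfar, rfl⟩
        change (X c * X d) * (t.map X).prod ∈ V
        rw [← hprod]
        refine ih _ ?_ _ rfl
        have h1 := sum_sq_le_sq_sum (c ::ₘ d ::ₘ t)
        rw [hs]
        simp only [Multiset.map_cons, Multiset.sum_cons, ← add_assoc] at h1 ⊢
        rw [hcd] at h1 ⊢
        have h2 : a ^ 2 + b ^ 2 < c ^ 2 + d ^ 2 := by nlinarith
        omega
    rw [hs, hprod]
    exact hsub (X_mul_X_mem hle hab)

lemma mem_relationIdeal_sup_separatedSpan (m : ℕ) (f : MvPolynomial ℕ ℂ) :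
    f ∈ (relationIdeal m).restrictScalars ℂ ⊔ separatedSpan m := by
  -- The extra monomial factor absorbs the variables as the induction on f peels them off.
  suffices ∀ s : Multiset ℕ, f * (s.map X).prod
      ∈ (relationIdeal m).restrictScalars ℂ ⊔ separatedSpan m by
    simpa using this 0
  induction f using MvPolynomial.induction_on with
  | C a =>
    intro s
    rw [← MvPolynomial.smul_eq_C_mul]
    exact Submodule.smul_mem _ _ (prod_X_mem m s)
  | add f g hf hg =>
    intro s
    rw [add_mul]
    exact Submodule.add_mem _ (hf s) (hg s)
  | mul_X f n hf =>
    intro s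
    have := hf (n ::ₘ s)
    rwa [Multiset.map_cons, Multiset.prod_cons, ← mul_assoc] at this

/-! ### The kernel and the isomorphism -/

lemma ker_orbitMap (m : ℕ) (hm : 1 ≤ m) (p : ℤ) :
    LinearMap.ker (orbitMap m hm p) = (relationIdeal m).restrictScalars ℂ := by
  refine le_antisymm (fun f hf => ?_) fun f hf => relationIdeal_le_ker_orbitMap m hm p hf
  obtain ⟨r, hr, g, hg, rfl⟩ := Submodule.mem_sup.1 (mem_relationIdeal_sup_separatedSpan m f)
  rw [LinearMap.mem_ker, map_add, relationIdeal_le_ker_orbitMap m hm p hr, zero_add] at hf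
  rwa [eq_zero_of_orbitMap_eq_zero m hm p hg hf, add_zero]

/-- The isomorphism of the quotient by the relations with the principal subspace. -/
def principalEquiv (m : ℕ) (hm : 1 ≤ m) (p : ℤ) :
    (MvPolynomial ℕ ℂ ⧸ relationIdeal m) ≃ₗ[ℂ] principalSubspace m p :=
  (Submodule.Quotient.restrictScalarsEquiv ℂ (relationIdeal m)).symm ≪≫ₗ
    Submodule.quotEquivOfEq _ _ (ker_orbitMap m hm p).symm ≪≫ₗ
    (orbitMap m hm p).quotKerEquivRange ≪≫ₗ
    LinearEquiv.ofEq _ _ (range_orbitMap m hm p)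

lemma principalEquiv_mk (m : ℕ) (hm : 1 ≤ m) (p : ℤ) (f : MvPolynomial ℕ ℂ) :
    (principalEquiv m hm p (Ideal.Quotient.mk (relationIdeal m) f) : FockSum)
      = orbitMap m hm p f := rfl

end LatticeVertex

end

theorem mainTheorem3 (m : ℕ) (hm : 1 ≤ m) :
    (LatticeVertex.relationIdeal m =
      Ideal.span {r : MvPolynomial ℕ ℂ | ∃ i < m, ∃ s : ℕ,
        r = ∑ α ∈ Finset.HasAntidiagonal.antidiagonal s,
          ((α.1.descFactorial i * α.2.descFactorial i : ℕ) : MvPolynomial ℕ ℂ) *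
            (MvPolynomial.X α.1 * MvPolynomial.X α.2)}) ∧
    ∀ p : ℤ, ∃ e : (MvPolynomial ℕ ℂ ⧸ LatticeVertex.relationIdeal m) ≃ₗ[ℂ]
        LatticeVertex.principalSubspace m p,
      (e 1 : LatticeVertex.FockSum) = LatticeVertex.extremalVector p ∧
      ∀ (j : ℕ) (x : MvPolynomial ℕ ℂ ⧸ LatticeVertex.relationIdeal m),
        (e (Ideal.Quotient.mk (LatticeVertex.relationIdeal m) (MvPolynomial.X j) * x) :
            LatticeVertex.FockSum) =
          LatticeVertex.mode m (p - 1 - j) (e x) := by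
  refine ⟨LatticeVertex.relationIdeal_eq_span m, fun p =>
    ⟨LatticeVertex.principalEquiv m hm p, ?_, fun j x => ?_⟩⟩
  · rw [← map_one (Ideal.Quotient.mk _), LatticeVertex.principalEquiv_mk,
      LatticeVertex.orbitMap_one]
  · obtain ⟨f, rfl⟩ := Ideal.Quotient.mk_surjective x
    rw [← map_mul, LatticeVertex.principalEquiv_mk, LatticeVertex.principalEquiv_mk,
      LatticeVertex.orbitMap_X_mul]
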